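/- Theorem 3.3. Let $X,X_1,X_2,\dots$ be independent, identically distributed real random variables with distribution function $F$, and put $\overline F=1-F$, $S_n=\sum_{i=1}^nX_i$, $\mu_1(t)=\int_{|x|\le t}x\,dF(x)$ and $\mu_2(t)=\int_{|x|\le t}x^2\,dF(x)$. Let $\alpha\ge0$ and suppose that $P[|X|>x]$ is regularly varying with index $-\alpha$, that is, $$\lim_{x\to\infty}\frac{P[|X|>\lambda x]}{P[|X|>x]}=\lambda^{-\alpha}\qquad\text{for all }\lambda\ge1.$$ Suppose also that $\sup_{x\ge0}F(-x)/\overline F(x)<\infty$ (that is, for some finite $p$, $F(-x)\le p\,\overline F(x)$ for all $x\ge0$), and let $(t_n)$ be a real sequence with $n\overline F(t_n)\to0$ as $n\to\infty$. If any one of the following holds: (i) $0\le\alpha<1$; (ii) $1\le\alpha<2$ and $\displaystyle\lim_{n\to\infty}\frac{n}{t_n}\mu_1(t_n)=0$; (iii) $\alpha\ge2$ and $\displaystyle\lim_{n\to\infty}\frac{nE(X)}{t_n}=\lim_{n\to\infty}\frac{n\mu_2(t_n)\log t_n}{t_n^2}=0$; then $$\lim_{n\to\infty}\sup_{s\ge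 t_n}\left|\frac{P[S_n>s]}{n\overline F(s)}-1\right|=0.$$ -/

import Mathlib

open MeasureTheory ProbabilityTheory Filter Topology

noncomputable section

namespace LargeDev

/-- `G` is regularly varying at infinity with index `ρ`: `G (c x) / G x → c ^ ρ` for all `c ≥ 1`.
For a nonnegative `G` the case `c = 1` forces `G` to be eventually positive. -/
def RegVarying (G : ℝ → ℝ) (ρ : ℝ) : Prop :=
  ∀ c : ℝ, 1 ≤ c → Tendsto (fun x => G (c * x) / G x) atTop (𝓝 (c ^ ρ))

/-- The tail `1 - F(x)` of the distribution function `F` of a law `ν`. -/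
def tail (ν : Measure ℝ) (x : ℝ) : ℝ := 1 - cdf ν x

/-- The two-sided tail `x ↦ ν {y : |y| > x}`, that is `P[|X| > x]` for `X` with law `ν`. -/
def absTail (ν : Measure ℝ) (x : ℝ) : ℝ := ν.real {y | x < |y|}

/-- The truncated moment `∫_{|y| ≤ x} y ^ k dν(y)`. -/
def truncMoment (ν : Measure ℝ) (k : ℕ) (x : ℝ) : ℝ := ∫ y in {y | |y| ≤ x}, y ^ k ∂ν

/-- The partial sum `S_n`, the sum of the first `n` terms of the sequence `X`. -/
def partialSum {Ω : Type*} (X : ℕ → Ω → ℝ) (n : ℕ) (ω : Ω) : ℝ := ∑ i ∈ Finset.range n, X i ω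

/-- `lim_n sup_{s ≥ t_n} |P[S_n > s] / (n (1 - F(s))) - 1| = 0`, where `F` is the distribution
function of `X 0`. The supremum is taken in `[0, ∞]`, so it is the true one even if infinite. -/
def UniformLargeDev {Ω : Type*} [MeasurableSpace Ω] (P : Measure Ω) (X : ℕ → Ω → ℝ)
    (t : ℕ → ℝ) : Prop :=
  Tendsto (fun n : ℕ => ⨆ s : ℝ, ⨆ _ : t n ≤ s,
    ENNReal.ofReal |P.real {ω | s < partialSum X n ω} / (n * tail (P.map (X 0)) s) - 1|)
    atTop (𝓝 0)

end LargeDev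

end

/-! A sum exceeds a high level `s` essentially only because a single summand does. Fix `c > 1` close
to 1. For the upper bound, either some summand exceeds `s / c`, or some summand exceeds `s / 3`
while the remaining ones add up to at least `(1 - 1 / c) * s` in absolute value, or no summand
exceeds `s / 3` (`measureReal_partialSum_gt_le`). The first event has probability at most about `n *
tail ν s`. In the second, independence supplies an extra factor that tends to 0 by Chebyshev. The
third is `O((n * absTail ν s) ^ 2)` by an exponential Markov inequality with parameter `3 * L / s`,
where `L = -log (n * absTail ν s)` (`chernoff_exponent_le`). For the lower bound, the events that
exactly one summand exceeds `c * s` while the others have a small sum are disjoint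
(`le_measureReal_partialSum_gt`).

These estimates need only `n * absTail ν s → 0`, `n * μ₁(s) / s → 0` and `L * n * μ₂(s) / s ^ 2 → 0`
along a sequence of levels; this is `tendsto_measureReal_partialSum_gt_div`. Karamata-type bounds
derive the three limits from each set of hypotheses, for every sequence of levels `s n ≥ t n`.
Having all such sequences is equivalent to uniformity (`uniformLargeDev_of_forall_seq`). -/

namespace LargeDev

set_option linter.unusedSectionVars false

/-! ### Tails, annuli and truncated moments of a law. -/

section Law

variable (ν : Measure ℝ) [IsProbabilityMeasure ν]

lemma tail_eq_measureReal_Ioi (x : ℝ) : tail ν x = ν.real (Set.Ioi x) := by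
  rw [tail, cdf_eq_real, ← Set.compl_Iic, measureReal_compl measurableSet_Iic]
  simp

lemma tail_nonneg (x : ℝ) : 0 ≤ tail ν x := by
  rw [tail_eq_measureReal_Ioi]; positivity

lemma tail_antitone : Antitone (tail ν) := by
  intro x y hxy
  rw [tail_eq_measureReal_Ioi, tail_eq_measureReal_Ioi]
  exact measureReal_mono (Set.Ioi_subset_Ioi hxy)

lemma absTail_nonneg (x : ℝ) : 0 ≤ absTail ν x := measureReal_nonneg

lemma absTail_antitone : Antitone (absTail ν) := by
  intro x y hxy
  exact measureReal_mono fun z (hz : y < |z|) => lt_of_le_of_lt hxy hz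

lemma tail_le_absTail (x : ℝ) : tail ν x ≤ absTail ν x := by
  rw [tail_eq_measureReal_Ioi]
  exact measureReal_mono fun z (hz : x < z) => lt_of_lt_of_le hz (le_abs_self z)

lemma absTail_le_mul_tail {p x : ℝ} (hp : cdf ν (-x) ≤ p * tail ν x) :
    absTail ν x ≤ (1 + p) * tail ν x := by
  have h : absTail ν x ≤ tail ν x + cdf ν (-x) := by
    rw [tail_eq_measureReal_Ioi, cdf_eq_real]
    refine le_trans (measureReal_mono ?_) (measureReal_union_le _ _)
    intro z (hz : x < |z|)
    rcases lt_abs.1 hz with h | h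
    · exact Or.inl h
    · exact Or.inr (show z ≤ -x by linarith)
  linarith

lemma measurableSet_lt_abs (x : ℝ) : MeasurableSet {y : ℝ | x < |y|} :=
  measurableSet_lt measurable_const measurable_abs

lemma measurableSet_abs_le (x : ℝ) : MeasurableSet {y : ℝ | |y| ≤ x} :=
  measurableSet_le measurable_abs measurable_const

lemma measurableSet_annulus (x y : ℝ) : MeasurableSet {z : ℝ | x < |z| ∧ |z| ≤ y} :=
  (measurableSet_lt_abs x).inter (measurableSet_abs_le y)

lemma measureReal_annulus {x y : ℝ} (hxy : x ≤ y) :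
    ν.real {z | x < |z| ∧ |z| ≤ y} = absTail ν x - absTail ν y := by
  have : {z : ℝ | x < |z| ∧ |z| ≤ y} = {z | x < |z|} \ {z | y < |z|} := by
    ext z; simp
  have hsub : {z : ℝ | y < |z|} ⊆ {z | x < |z|} :=
    fun z (hz : y < |z|) => lt_of_le_of_lt hxy hz
  rw [this, measureReal_sdiff hsub (measurableSet_lt_abs y)]
  rfl

/-- Only the two-sided tail is regularly varying by hypothesis; this transfers control of its
increments to the one-sided tail. -/
lemma tail_sub_tail_le {x y : ℝ} (hx : 0 ≤ x) (hxy : x ≤ y) :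
    tail ν x - tail ν y ≤ absTail ν x - absTail ν y := by
  have : tail ν x - tail ν y = ν.real (Set.Ioc x y) := by
    rw [tail_eq_measureReal_Ioi, tail_eq_measureReal_Ioi,
      ← measureReal_sdiff (Set.Ioi_subset_Ioi hxy) measurableSet_Ioi]
    congr 1; ext z; simp
  rw [this, ← measureReal_annulus ν hxy]
  refine measureReal_mono ?_
  intro z hz
  have : |z| = z := abs_of_nonneg (hx.trans hz.1.le)
  exact ⟨hz.1.trans_eq this.symm, this.trans_le hz.2⟩

lemma integrableOn_of_bounded {f : ℝ → ℝ} (hf : Measurable f) {A : Set ℝ} (hA : MeasurableSet A)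
    {C : ℝ} (hC : ∀ y ∈ A, |f y| ≤ C) : IntegrableOn f A ν :=
  Measure.integrableOn_of_bounded (M := C) (measure_ne_top _ _) hf.aestronglyMeasurable
    ((ae_restrict_iff' hA).2 (Eventually.of_forall fun y hy => by simpa using hC y hy))

lemma integrableOn_pow_abs_le (k : ℕ) (x : ℝ) : IntegrableOn (fun y => y ^ k) {y | |y| ≤ x} ν :=
  integrableOn_of_bounded ν (by fun_prop) (measurableSet_abs_le x) (C := x ^ k)
    fun y hy => by rw [abs_pow]; exact pow_le_pow_left₀ (abs_nonneg y) hy k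

lemma integrableOn_abs_pow_abs_le (k : ℕ) (x : ℝ) :
    IntegrableOn (fun y => |y| ^ k) {y | |y| ≤ x} ν :=
  integrableOn_of_bounded ν (by fun_prop) (measurableSet_abs_le x) (C := x ^ k)
    fun y hy => by rw [abs_pow, abs_abs]; exact pow_le_pow_left₀ (abs_nonneg y) hy k

lemma annulus_union {x y : ℝ} (hxy : x ≤ y) :
    {z : ℝ | |z| ≤ y} = {z | |z| ≤ x} ∪ {z | x < |z| ∧ |z| ≤ y} := by
  ext z
  simp only [Set.mem_ofPred_eq, Set.mem_union]
  constructor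
  · intro h
    rcases le_or_gt |z| x with h' | h'
    · exact Or.inl h'
    · exact Or.inr ⟨h', h⟩
  · rintro (h | h)
    · exact h.trans hxy
    · exact h.2

lemma setIntegral_abs_le_eq_add {f : ℝ → ℝ} {x y : ℝ} (hxy : x ≤ y)
    (hf : IntegrableOn f {z | |z| ≤ y} ν) :
    ∫ z in {z | |z| ≤ y}, f z ∂ν
      = (∫ z in {z | |z| ≤ x}, f z ∂ν) + ∫ z in {z | x < |z| ∧ |z| ≤ y}, f z ∂ν := by
  rw [annulus_union hxy] at hf ⊢
  refine setIntegral_union ?_ (measurableSet_annulus x y) hf.left_of_union hf.right_of_union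
  rw [Set.disjoint_left]
  rintro z (h : |z| ≤ x) h'
  exact absurd h'.1 (not_lt.2 h)

lemma setIntegral_annulus_abs_pow_le (k : ℕ) {x y : ℝ} (hxy : x ≤ y) (hy : 0 ≤ y) :
    ∫ z in {z | x < |z| ∧ |z| ≤ y}, |z| ^ k ∂ν ≤ y ^ k * absTail ν x := by
  have h1 : ∫ z in {z | x < |z| ∧ |z| ≤ y}, |z| ^ k ∂ν
      ≤ ∫ z in {z | x < |z| ∧ |z| ≤ y}, y ^ k ∂ν := by
    refine setIntegral_mono_on ?_ (integrableOn_const (measure_ne_top _ _))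
      (measurableSet_annulus x y) fun z hz => pow_le_pow_left₀ (abs_nonneg z) hz.2 k
    exact (integrableOn_abs_pow_abs_le ν k y).mono_set fun z hz => hz.2
  refine h1.trans ?_
  rw [setIntegral_const, smul_eq_mul, measureReal_annulus ν hxy, mul_comm]
  have := absTail_nonneg ν y
  gcongr; linarith

lemma truncMoment_two_eq (x : ℝ) :
    truncMoment ν 2 x = ∫ y in {y | |y| ≤ x}, |y| ^ 2 ∂ν := by
  simp [truncMoment]

lemma truncMoment_two_nonneg (x : ℝ) : 0 ≤ truncMoment ν 2 x :=
  integral_nonneg fun y => sq_nonneg y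

lemma truncMoment_two_mono : Monotone (truncMoment ν 2) := by
  intro x y hxy
  exact setIntegral_mono_set (integrableOn_pow_abs_le ν 2 y)
    (Eventually.of_forall fun y => sq_nonneg y)
    (Eventually.of_forall fun z (hz : |z| ≤ x) => hz.trans hxy)

lemma abs_truncMoment_one_le (x : ℝ) :
    |truncMoment ν 1 x| ≤ ∫ y in {y | |y| ≤ x}, |y| ^ 1 ∂ν := by
  refine (abs_integral_le_integral_abs).trans (le_of_eq ?_)
  simp

/-- Moving the truncation level costs only a tail term, since the integrand is at most `y` on the
annulus. -/
lemma abs_truncMoment_one_sub_le {x y : ℝ} (hxy : x ≤ y) (hy : 0 ≤ y) :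
    |truncMoment ν 1 y - truncMoment ν 1 x| ≤ y * absTail ν x := by
  rw [truncMoment, truncMoment,
    setIntegral_abs_le_eq_add ν hxy (integrableOn_pow_abs_le ν 1 y), add_sub_cancel_left]
  refine (abs_integral_le_integral_abs).trans ?_
  have := setIntegral_annulus_abs_pow_le ν 1 hxy hy
  simpa using this

end Law

/-! ### Consequences of regular variation. -/

section RegularVariation

variable {G : ℝ → ℝ} {α : ℝ}

lemma RegVarying.eventually_pos (hG : ∀ x, 0 ≤ G x) (h : RegVarying G (-α)) :
    ∀ᶠ x in atTop, 0 < G x := by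
  have h1 := h 1 le_rfl
  rw [Real.one_rpow] at h1
  filter_upwards [h1.eventually (lt_mem_nhds (show (0 : ℝ) < 1 by norm_num))] with x hx
  refine lt_of_le_of_ne (hG x) fun h0 => ?_
  -- Division by zero returns 0, so a zero of `G` would make the quotient for `c = 1` vanish.
  simp [← h0] at hx

lemma RegVarying.pos (hG : ∀ x, 0 ≤ G x) (hanti : Antitone G) (h : RegVarying G (-α)) (x : ℝ) :
    0 < G x := by
  obtain ⟨y, hy, hxy⟩ := ((h.eventually_pos hG).and (eventually_ge_atTop x)).exists
  exact hy.trans_le (hanti hxy)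

lemma RegVarying.eventually_mul_le (hG : ∀ x, 0 < G x) (h : RegVarying G (-α)) {c q : ℝ}
    (hc : 1 ≤ c) (hq : c ^ (-α) < q) : ∀ᶠ x in atTop, G (c * x) ≤ q * G x := by
  filter_upwards [(h c hc).eventually (gt_mem_nhds hq)] with x hx
  exact ((div_lt_iff₀ (hG x)).1 hx).le

lemma RegVarying.eventually_le_mul (hG : ∀ x, 0 < G x) (h : RegVarying G (-α)) {c q : ℝ}
    (hc : 1 ≤ c) (hq : q < c ^ (-α)) : ∀ᶠ x in atTop, q * G x ≤ G (c * x) := by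
  filter_upwards [(h c hc).eventually (lt_mem_nhds hq)] with x hx
  exact ((lt_div_iff₀ (hG x)).1 hx).le

lemma RegVarying.eventually_le_mul_double (hG : ∀ x, 0 < G x) (h : RegVarying G (-α)) {q : ℝ}
    (hq : (2 : ℝ) ^ α < q) : ∀ᶠ x in atTop, G x ≤ q * G (2 * x) := by
  have h2 : (0 : ℝ) < 2 ^ α := by positivity
  have hq0 : 0 < q := h2.trans hq
  have : q⁻¹ < (2 : ℝ) ^ (-α) := by
    rw [Real.rpow_neg (by norm_num)]
    exact inv_strictAnti₀ h2 hq
  filter_upwards [h.eventually_le_mul hG one_le_two this] with x hx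
  rwa [inv_mul_le_iff₀ hq0] at hx

/-- A Potter type bound. -/
lemma RegVarying.exists_potter (hG : ∀ x, 0 < G x) (hanti : Antitone G) (h : RegVarying G (-α)) :
    ∃ (a : ℕ) (C x₀ : ℝ), 0 < C ∧ 0 < x₀ ∧
      ∀ x y, x₀ ≤ x → x ≤ y → G x ≤ C * (y / x) ^ a * G y := by
  obtain ⟨a, ha⟩ := exists_nat_gt α
  have hq : (2 : ℝ) ^ α < 2 ^ a := by
    rw [← Real.rpow_natCast]
    exact Real.rpow_lt_rpow_of_exponent_lt one_lt_two ha
  obtain ⟨x₁, hx₁⟩ := eventually_atTop.1 (h.eventually_le_mul_double hG hq)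
  refine ⟨a, 2 ^ a, max x₁ 1, by positivity, by positivity, fun x y hx hxy => ?_⟩
  have hx0 : 0 < x := lt_of_lt_of_le (by norm_num) ((le_max_right _ _).trans hx)
  -- Iterate the doubling inequality; any natural exponent above `α` leaves the room it needs.
  have key : ∀ j : ℕ, G x ≤ (2 ^ j) ^ a * G (2 ^ j * x) := by
    intro j
    induction j with
    | zero => simp
    | succ j ih =>
      have h1 : x₁ ≤ 2 ^ j * x := by
        have : x ≤ 2 ^ j * x := le_mul_of_one_le_left hx0.le (one_le_pow₀ (by norm_num))
        exact ((le_max_left _ _).trans hx).trans this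
      have h2 := hx₁ _ h1
      calc G x ≤ (2 ^ j) ^ a * G (2 ^ j * x) := ih
        _ ≤ (2 ^ j) ^ a * (2 ^ a * G (2 * (2 ^ j * x))) := by gcongr
        _ = _ := by rw [show (2 : ℝ) * (2 ^ j * x) = 2 ^ (j + 1) * x by ring, pow_succ, mul_pow]; ring
  have hyx : 1 ≤ y / x := (one_le_div hx0).2 hxy
  -- Rounding `y / x` up to the next power of 2 costs the constant `2 ^ a`.
  obtain ⟨j, hj1, hj2⟩ := exists_nat_pow_near hyx (one_lt_two : (1 : ℝ) < 2)
  calc G x ≤ (2 ^ (j + 1)) ^ a * G (2 ^ (j + 1) * x) := key _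
    _ ≤ (2 ^ (j + 1)) ^ a * G y := by
        gcongr
        exact hanti ((div_lt_iff₀ hx0).1 hj2).le
    _ = 2 ^ a * (2 ^ j) ^ a * G y := by rw [pow_succ, mul_pow]; ring
    _ ≤ 2 ^ a * (y / x) ^ a * G y := by
        have := (hG y).le
        gcongr

end RegularVariation

/-! ### Karamata bounds by dyadic induction. -/

section Karamata

variable (ν : Measure ℝ) [IsProbabilityMeasure ν] {α : ℝ}

/-- Passing from `s / 2` to `s` multiplies `s ^ k * absTail ν s` by at least `2 ^ k / q > 1`,
because `α < k`. The dyadic annuli therefore contribute a geometric sum dominated by its top term.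
-/
lemma exists_absMoment_le (hpos : ∀ x, 0 < absTail ν x) (h : RegVarying (absTail ν) (-α)) (k : ℕ)
    (hk : α < k) :
    ∃ C : ℝ, ∀ᶠ s in atTop, ∫ y in {y | |y| ≤ s}, |y| ^ k ∂ν ≤ C * s ^ k * absTail ν s := by
  obtain ⟨q, hq1, hq2⟩ := exists_between
    (Real.rpow_lt_rpow_of_exponent_lt (one_lt_two : (1 : ℝ) < 2) hk)
  rw [Real.rpow_natCast] at hq2
  have hq0 : 0 < q := lt_trans (by positivity) hq1
  obtain ⟨x₁, hx₁⟩ := eventually_atTop.1 (h.eventually_le_mul_double hpos hq1)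
  set x₀ := max x₁ 1 with hx₀
  have hx₀0 : 0 < x₀ := by positivity
  -- The first entry makes the trivial bound `M s ≤ s ^ k` suffice on the initial range; the second
  -- says `(C / 2 ^ k + 1) * q ≤ C`, which closes the induction.
  set C := max (2 ^ k / absTail ν (2 * x₀)) (2 ^ k * q / (2 ^ k - q)) with hC
  have hC1 : 2 ^ k ≤ C * absTail ν (2 * x₀) := by
    rw [← div_le_iff₀ (hpos _)]; exact le_max_left _ _
  have hC2 : 2 ^ k * q ≤ C * (2 ^ k - q) := by
    rw [← div_le_iff₀ (by linarith)]; exact le_max_right _ _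
  have hC0 : 0 ≤ C := le_trans (by have := hpos (2 * x₀); positivity) (le_max_left _ _)
  set M : ℝ → ℝ := fun s => ∫ y in {y | |y| ≤ s}, |y| ^ k ∂ν with hM
  have key : ∀ j : ℕ, ∀ s, x₀ ≤ s → s < 2 ^ (j + 1) * x₀ → M s ≤ C * s ^ k * absTail ν s := by
    intro j
    induction j with
    | zero =>
      intro s hs1 hs2
      have hs0 : 0 < s := hx₀0.trans_le hs1
      have h1 : M s ≤ s ^ k := by
        have := setIntegral_mono_on (integrableOn_abs_pow_abs_le ν k s)
          (integrableOn_const (C := s ^ k) (measure_ne_top _ _)) (measurableSet_abs_le s)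
          fun z (hz : |z| ≤ s) => pow_le_pow_left₀ (abs_nonneg z) hz k
        refine this.trans ?_
        rw [setIntegral_const, smul_eq_mul]
        exact mul_le_of_le_one_left (by positivity) measureReal_le_one
      have h2 : absTail ν (2 * x₀) ≤ absTail ν s := absTail_antitone ν (by simpa using hs2.le)
      have h3 : 1 ≤ C * absTail ν s := calc
        (1 : ℝ) ≤ 2 ^ k := one_le_pow₀ (by norm_num)
        _ ≤ C * absTail ν (2 * x₀) := hC1
        _ ≤ C * absTail ν s := by gcongr
      calc M s ≤ s ^ k := h1
        _ ≤ s ^ k * (C * absTail ν s) := le_mul_of_one_le_right (by positivity) h3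
        _ = _ := by ring
    | succ j ih =>
      intro s hs1 hs2
      rcases lt_or_ge s (2 ^ (j + 1) * x₀) with h' | h'
      · exact ih s hs1 h'
      have hs0 : 0 < s := hx₀0.trans_le hs1
      have hhalf : x₀ ≤ s / 2 := by
        have : (2 : ℝ) * x₀ ≤ 2 ^ (j + 1) * x₀ := by
          gcongr; rw [pow_succ]
          exact le_mul_of_one_le_left (by norm_num) (one_le_pow₀ (by norm_num))
        linarith
      have h1 := ih (s / 2) hhalf (by rw [pow_succ] at hs2; linarith)
      have h2 := setIntegral_abs_le_eq_add ν (show s / 2 ≤ s by linarith)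
        (integrableOn_abs_pow_abs_le ν k s)
      have h3 := setIntegral_annulus_abs_pow_le ν k (show s / 2 ≤ s by linarith) hs0.le
      have h4 := hx₁ (s / 2) ((le_max_left _ _).trans hhalf)
      rw [show 2 * (s / 2) = s by ring] at h4
      have h5 : M s ≤ (C / 2 ^ k + 1) * s ^ k * absTail ν (s / 2) := by
        rw [hM] at h1 ⊢
        simp only at h1 ⊢
        rw [h2]
        calc _ ≤ C * (s / 2) ^ k * absTail ν (s / 2) + s ^ k * absTail ν (s / 2) := add_le_add h1 h3
          _ = _ := by rw [div_pow]; ring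
      calc M s ≤ (C / 2 ^ k + 1) * s ^ k * absTail ν (s / 2) := h5
        _ ≤ (C / 2 ^ k + 1) * s ^ k * (q * absTail ν s) := by gcongr
        _ = ((C / 2 ^ k + 1) * q) * (s ^ k * absTail ν s) := by ring
        _ ≤ C * (s ^ k * absTail ν s) := by
            have := (hpos s).le
            gcongr
            rw [div_add_one (by positivity), div_mul_eq_mul_div, div_le_iff₀ (by positivity)]
            linarith
        _ = _ := by ring
  refine ⟨C, eventually_atTop.2 ⟨x₀, fun s hs => ?_⟩⟩
  obtain ⟨j, -, hj⟩ := exists_nat_pow_near ((one_le_div hx₀0).2 hs) (one_lt_two : (1 : ℝ) < 2)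
  exact key j s hs ((div_lt_iff₀ hx₀0).1 hj)

/-- When `α > 1` the annulus from `2 ^ j * s` to `2 ^ (j + 1) * s` contributes a term that decays
geometrically in `j`, so the lowest annulus dominates. -/
lemma exists_absMoment_gt_le (hpos : ∀ x, 0 < absTail ν x) (h : RegVarying (absTail ν) (-α))
    (hα : 1 < α) :
    ∃ C : ℝ, 0 ≤ C ∧ ∀ᶠ s in atTop, IntegrableOn (fun y => |y|) {y | s < |y|} ν ∧
      ∫ y in {y | s < |y|}, |y| ∂ν ≤ C * s * absTail ν s := by
  have h12 : (2 : ℝ) ^ (-α) < 1 / 2 := by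
    rw [Real.rpow_neg (by norm_num), ← one_div]
    refine one_div_lt_one_div_of_lt (by norm_num) ?_
    nth_rewrite 1 [← Real.rpow_one 2]
    exact Real.rpow_lt_rpow_of_exponent_lt one_lt_two hα
  obtain ⟨q, hq1, hq2⟩ := exists_between h12
  have hq0 : 0 < q := lt_trans (by positivity) hq1
  obtain ⟨x₁, hx₁⟩ := eventually_atTop.1 (h.eventually_mul_le hpos one_le_two hq1)
  -- The fixed point of `C = 2 + 2 * q * C`, positive because `q < 1 / 2`.
  set C := 2 / (1 - 2 * q) with hC
  have hC0 : 0 ≤ C := div_nonneg (by norm_num) (by linarith)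
  have hC1 : 2 + 2 * C * q = C := by
    have : 1 - 2 * q ≠ 0 := by linarith
    rw [hC]; field_simp; ring
  -- Integrability over the whole tail is not yet known, so the bound is proved on bounded annuli,
  -- uniformly in `j`; monotone convergence then yields integrability and the estimate together.
  have key : ∀ j : ℕ, ∀ s, max x₁ 1 ≤ s →
      ∫ z in {z | s < |z| ∧ |z| ≤ 2 ^ j * s}, |z| ∂ν ≤ C * s * absTail ν s := by
    intro j
    induction j with
    | zero =>
      intro s hs
      have hs0 : 0 < s := lt_of_lt_of_le (by norm_num) ((le_max_right _ _).trans hs)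
      have : {z : ℝ | s < |z| ∧ |z| ≤ 2 ^ 0 * s} = ∅ := by
        ext z; simp
      rw [this]
      have := (hpos s).le
      simp; positivity
    | succ j ih =>
      intro s hs
      have hs0 : 0 < s := lt_of_lt_of_le (by norm_num) ((le_max_right _ _).trans hs)
      have hpow : (1 : ℝ) ≤ 2 ^ j := one_le_pow₀ (by norm_num)
      have hle : 2 * s ≤ 2 ^ (j + 1) * s := by rw [pow_succ]; nlinarith
      have hset : {z : ℝ | s < |z| ∧ |z| ≤ 2 ^ (j + 1) * s}
          = {z | s < |z| ∧ |z| ≤ 2 * s} ∪ {z | 2 * s < |z| ∧ |z| ≤ 2 ^ j * (2 * s)} := by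
        ext z
        simp only [Set.mem_ofPred_eq, Set.mem_union]
        rw [show (2 : ℝ) ^ j * (2 * s) = 2 ^ (j + 1) * s by ring]
        constructor
        · rintro ⟨h1, h2⟩
          rcases le_or_gt |z| (2 * s) with h' | h'
          · exact Or.inl ⟨h1, h'⟩
          · exact Or.inr ⟨h', h2⟩
        · rintro (⟨h1, h2⟩ | ⟨h1, h2⟩)
          · exact ⟨h1, h2.trans hle⟩
          · exact ⟨by linarith, h2⟩
      have hint : ∀ x y : ℝ, IntegrableOn (fun z => |z|) {z | x < |z| ∧ |z| ≤ y} ν := fun x y =>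
        integrableOn_of_bounded ν (by fun_prop) (measurableSet_annulus x y) (C := y)
          fun z hz => by rw [abs_abs]; exact hz.2
      rw [hset, setIntegral_union ?_ (measurableSet_annulus _ _) (hint _ _) (hint _ _)]
      · have h1 := setIntegral_annulus_abs_pow_le ν 1 (show s ≤ 2 * s by linarith) (by linarith)
        simp only [pow_one] at h1
        have h2 := ih (2 * s) (by linarith)
        have h3 := hx₁ s ((le_max_left _ _).trans hs)
        calc _ ≤ 2 * s * absTail ν s + C * (2 * s) * absTail ν (2 * s) := add_le_add h1 h2
          _ ≤ 2 * s * absTail ν s + C * (2 * s) * (q * absTail ν s) := by gcongr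
          _ = (2 + 2 * C * q) * s * absTail ν s := by ring
          _ = _ := by rw [hC1]
      · rw [Set.disjoint_left]
        rintro z h1 h2
        exact absurd h2.1 (not_lt.2 h1.2)
  refine ⟨C, hC0, eventually_atTop.2 ⟨max x₁ 1, fun s hs => ?_⟩⟩
  have hs0 : 0 < s := lt_of_lt_of_le (by norm_num) ((le_max_right _ _).trans hs)
  have hB : 0 ≤ C * s * absTail ν s := by have := (hpos s).le; positivity
  have hU : {z : ℝ | s < |z|} = ⋃ j : ℕ, {z | s < |z| ∧ |z| ≤ 2 ^ j * s} := by
    ext z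
    simp only [Set.mem_ofPred_eq, Set.mem_iUnion]
    refine ⟨fun hz => ?_, fun ⟨_, hz, _⟩ => hz⟩
    obtain ⟨j, hj⟩ := pow_unbounded_of_one_lt (|z| / s) (one_lt_two : (1 : ℝ) < 2)
    exact ⟨j, hz, ((div_lt_iff₀ hs0).1 hj).le⟩
  have hlin : ∫⁻ z in {z | s < |z|}, ENNReal.ofReal |z| ∂ν
      ≤ ENNReal.ofReal (C * s * absTail ν s) := by
    rw [hU, setLIntegral_iUnion_of_directed]
    · refine iSup_le fun j => ?_
      have hint : IntegrableOn (fun z => |z|) {z | s < |z| ∧ |z| ≤ 2 ^ j * s} ν :=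
        integrableOn_of_bounded ν (by fun_prop) (measurableSet_annulus _ _) (C := 2 ^ j * s)
          fun z hz => by rw [abs_abs]; exact hz.2
      rw [← ofReal_integral_eq_lintegral_ofReal hint (Eventually.of_forall fun z => abs_nonneg z)]
      exact ENNReal.ofReal_le_ofReal (key j s hs)
    · refine Monotone.directed_le fun i j hij z hz => ⟨hz.1, hz.2.trans ?_⟩
      gcongr; norm_num
  have hInt : IntegrableOn (fun y => |y|) {y | s < |y|} ν := by
    refine ⟨by fun_prop, ?_⟩
    rw [hasFiniteIntegral_iff_ofReal (Eventually.of_forall fun z => abs_nonneg z)]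
    exact hlin.trans_lt ENNReal.ofReal_lt_top
  refine ⟨hInt, ?_⟩
  rw [← ENNReal.ofReal_le_ofReal_iff hB, ofReal_integral_eq_lintegral_ofReal hInt
    (Eventually.of_forall fun z => abs_nonneg z)]
  exact hlin

end Karamata

/-! ### Exponential moment of the variable truncated from above. -/

section ExponentialMoment

variable (ν : Measure ℝ) [IsProbabilityMeasure ν]

/-- Below `l⁻¹` a second-order Taylor bound applies. The extra cut at `m / 2` matters: the full
factor `exp (l * m)` is paid only against the tail at a level comparable to `m`, while the tail at
the much lower level `l⁻¹` meets only `exp (l * m / 2)`. -/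
lemma exp_indicator_sub_one_le {l m x : ℝ} (hl : 0 < l) (hm : l⁻¹ ≤ m / 2) :
    Real.exp (l * (Set.Iic m).indicator id x) - 1 ≤
      {y : ℝ | |y| ≤ l⁻¹}.indicator (fun y => l * y ^ 1 + l ^ 2 * y ^ 2) x
      + Real.exp (l * m / 2) * {y : ℝ | l⁻¹ < |y|}.indicator 1 x
      + Real.exp (l * m) * {y : ℝ | m / 2 < |y|}.indicator 1 x := by
  have hr : 0 < l⁻¹ := inv_pos.2 hl
  have nn : ∀ (a b : ℝ), 0 ≤ Real.exp b * {y : ℝ | a < |y|}.indicator 1 x := fun a b =>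
    mul_nonneg (Real.exp_pos _).le (Set.indicator_nonneg (fun _ _ => zero_le_one) _)
  have n1 := nn l⁻¹ (l * m / 2)
  have n2 := nn (m / 2) (l * m)
  rcases le_or_gt |x| l⁻¹ with hx | hx
  · have hxm : x ≤ m := (le_abs_self x).trans (by linarith)
    rw [Set.indicator_of_mem (show x ∈ Set.Iic m from hxm),
      Set.indicator_of_mem (show x ∈ {y : ℝ | |y| ≤ l⁻¹} from hx)]
    have h1 : |l * x| ≤ 1 := by
      rw [abs_mul, abs_of_pos hl]
      calc l * |x| ≤ l * l⁻¹ := by gcongr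
        _ = 1 := mul_inv_cancel₀ hl.ne'
    have h2 := (abs_le.1 (Real.abs_exp_sub_one_sub_id_le h1)).2
    simp only [id]
    nlinarith
  · rw [Set.indicator_of_notMem (show x ∉ {y : ℝ | |y| ≤ l⁻¹} from not_le.2 hx)]
    rcases le_or_gt x 0 with hx0 | hx0
    · have : Real.exp (l * (Set.Iic m).indicator id x) ≤ 1 := by
        rw [Real.exp_le_one_iff, Set.indicator_of_mem (show x ∈ Set.Iic m by
          simp only [Set.mem_Iic]; linarith)]
        exact mul_nonpos_of_nonneg_of_nonpos hl.le hx0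
      linarith
    rcases le_or_gt x (m / 2) with hx2 | hx2
    · rw [Set.indicator_of_mem (show x ∈ Set.Iic m by simp only [Set.mem_Iic]; linarith)]
      rw [Set.indicator_of_mem (show x ∈ {y : ℝ | l⁻¹ < |y|} from hx)] at n1 ⊢
      have : Real.exp (l * id x) ≤ Real.exp (l * m / 2) := by
        rw [Real.exp_le_exp, mul_div_assoc]; simp only [id]; gcongr
      simp only [Pi.one_apply, mul_one] at n1 ⊢
      linarith
    · have hx2' : x ∈ {y : ℝ | m / 2 < |y|} := lt_of_lt_of_le hx2 (le_abs_self x)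
      rw [Set.indicator_of_mem hx2'] at n2 ⊢
      simp only [Pi.one_apply, mul_one] at n2 ⊢
      rcases le_or_gt x m with hxm | hxm
      · rw [Set.indicator_of_mem (show x ∈ Set.Iic m from hxm)]
        have : Real.exp (l * id x) ≤ Real.exp (l * m) := by
          rw [Real.exp_le_exp]; simp only [id]; gcongr
        linarith
      · rw [Set.indicator_of_notMem (show x ∉ Set.Iic m from not_le.2 hxm)]
        simp only [mul_zero, Real.exp_zero]
        linarith

lemma integrable_exp_indicator {l m : ℝ} (hl : 0 < l) :
    Integrable (fun x => Real.exp (l * (Set.Iic m).indicator id x)) ν := by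
  have hmeas : Measurable ((Set.Iic m).indicator (id : ℝ → ℝ)) :=
    measurable_id.indicator measurableSet_Iic
  refine Integrable.of_bound (C := Real.exp (l * max m 0)) (by fun_prop)
    (Eventually.of_forall fun x => ?_)
  rw [Real.norm_of_nonneg (Real.exp_pos _).le, Real.exp_le_exp]
  gcongr
  by_cases hx : x ∈ Set.Iic m
  · rw [Set.indicator_of_mem hx]; exact le_max_of_le_left hx
  · rw [Set.indicator_of_notMem hx]; exact le_max_right _ _

lemma integral_exp_indicator_le {l m : ℝ} (hl : 0 < l) (hm : l⁻¹ ≤ m / 2) :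
    ∫ x, Real.exp (l * (Set.Iic m).indicator id x) ∂ν ≤
      Real.exp (l * truncMoment ν 1 l⁻¹ + l ^ 2 * truncMoment ν 2 l⁻¹
        + Real.exp (l * m / 2) * absTail ν l⁻¹ + Real.exp (l * m) * absTail ν (m / 2)) := by
  have e1 : IntegrableOn (fun y : ℝ => l * y ^ 1) {y | |y| ≤ l⁻¹} ν :=
    (integrableOn_pow_abs_le ν 1 _).const_mul _
  have e2 : IntegrableOn (fun y : ℝ => l ^ 2 * y ^ 2) {y | |y| ≤ l⁻¹} ν :=
    (integrableOn_pow_abs_le ν 2 _).const_mul _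
  have i1 : Integrable ({y : ℝ | |y| ≤ l⁻¹}.indicator (fun y => l * y ^ 1 + l ^ 2 * y ^ 2)) ν :=
    (integrable_indicator_iff (measurableSet_abs_le _)).2 (e1.add e2)
  have i2 : ∀ a b : ℝ, Integrable
      (fun x => Real.exp b * {y : ℝ | a < |y|}.indicator (1 : ℝ → ℝ) x) ν := fun a b =>
    ((integrable_indicator_iff (measurableSet_lt_abs _)).2
      (integrableOn_const (C := (1 : ℝ)) (measure_ne_top _ _))).const_mul _
  have i3 : Integrable (fun x => {y : ℝ | |y| ≤ l⁻¹}.indicator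
      (fun y => l * y ^ 1 + l ^ 2 * y ^ 2) x +
      Real.exp (l * m / 2) * {y : ℝ | l⁻¹ < |y|}.indicator 1 x) ν := i1.add (i2 _ _)
  have hexp := integrable_exp_indicator ν (m := m) hl
  have h : ∫ x, (Real.exp (l * (Set.Iic m).indicator id x) - 1) ∂ν ≤ _ :=
    integral_mono (hexp.sub (integrable_const _)) (i3.add (i2 _ _))
      fun x => exp_indicator_sub_one_le hl hm
  simp only [Pi.add_apply] at h
  rw [integral_sub hexp (integrable_const _), integral_add i3 (i2 _ _),
    integral_add i1 (i2 _ _), integral_const_mul, integral_const_mul,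
    integral_indicator (measurableSet_abs_le _), integral_add e1 e2, integral_const_mul,
    integral_const_mul, integral_indicator_one (measurableSet_lt_abs _),
    integral_indicator_one (measurableSet_lt_abs _)] at h
  -- Writing the bound as an exponential turns the product over `n` independent factors into a
  -- multiple of the exponent.
  refine le_trans ?_ (Real.add_one_le_exp _)
  simp only [integral_const, probReal_univ, smul_eq_mul, mul_one] at h
  unfold truncMoment absTail
  linarith

end ExponentialMoment

/-! ### Upper and lower bounds for the sum at a fixed `n`. -/

section Sums

variable {Ω : Type*} [MeasurableSpace Ω] {P : Measure Ω} [IsProbabilityMeasure P]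
  {X : ℕ → Ω → ℝ} {ν : Measure ℝ} [IsProbabilityMeasure ν]

lemma measureReal_preimage_eq (hmeas : ∀ i, Measurable (X i)) (hν : ∀ i, P.map (X i) = ν) (i : ℕ)
    {B : Set ℝ} (hB : MeasurableSet B) : P.real (X i ⁻¹' B) = ν.real B := by
  rw [← hν i, map_measureReal_apply (hmeas i) hB]

lemma integral_comp_eq (hmeas : ∀ i, Measurable (X i)) (hν : ∀ i, P.map (X i) = ν) (i : ℕ)
    {f : ℝ → ℝ} (hf : Measurable f) : ∫ ω, f (X i ω) ∂P = ∫ x, f x ∂ν := by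
  rw [← hν i, integral_map (hmeas i).aemeasurable hf.aestronglyMeasurable]

lemma measureReal_inter_sum_eq_mul (hmeas : ∀ i, Measurable (X i)) (hindep : iIndepFun X P)
    (hν : ∀ i, P.map (X i) = ν) {A : Finset ℕ} {i : ℕ} (hi : i ∉ A) {B C : Set ℝ}
    (hB : MeasurableSet B) (hC : MeasurableSet C) :
    P.real (X i ⁻¹' B ∩ {ω | ∑ j ∈ A, X j ω ∈ C}) =
      ν.real B * P.real {ω | ∑ j ∈ A, X j ω ∈ C} := by
  have h := (hindep.indepFun_finsetSum_of_notMem hmeas hi).symm.measure_inter_preimage_eq_mul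
    B C hB hC
  have hs : (∑ j ∈ A, X j) ⁻¹' C = {ω | ∑ j ∈ A, X j ω ∈ C} := by
    ext ω; simp
  rw [hs] at h
  rw [measureReal_def, h, ENNReal.toReal_mul, ← measureReal_def, ← measureReal_def,
    measureReal_preimage_eq hmeas hν i hB]

/-- Chebyshev's inequality for a sum of truncated variables. -/
lemma measureReal_le_abs_sum_le (hmeas : ∀ i, Measurable (X i)) (hindep : iIndepFun X P)
    (hν : ∀ i, P.map (X i) = ν) (A : Finset ℕ) {n : ℕ} (hA : A.card ≤ n) {s u : ℝ} (hu : 0 < u) :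
    P.real {ω | u ≤ |∑ j ∈ A, X j ω|} ≤
      n * absTail ν s + (n * truncMoment ν 2 s + (n * truncMoment ν 1 s) ^ 2) / u ^ 2 := by
  set T : ℝ → ℝ := {y : ℝ | |y| ≤ s}.indicator id with hT
  have hTm : Measurable T := measurable_id.indicator (measurableSet_abs_le s)
  set Y : ℕ → Ω → ℝ := fun i ω => T (X i ω) with hY
  have hYm : ∀ i, Measurable (Y i) := fun i => hTm.comp (hmeas i)
  have hYind : iIndepFun Y P := hindep.comp (fun _ => T) fun _ => hTm
  have hTb : ∀ x, |T x| ≤ |s| := by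
    intro x
    by_cases hx : x ∈ {y : ℝ | |y| ≤ s}
    · rw [hT, Set.indicator_of_mem hx]; exact le_trans hx (le_abs_self s)
    · rw [hT, Set.indicator_of_notMem hx]; simp
  have hYL : ∀ i, MemLp (Y i) 2 P := fun i =>
    MemLp.of_bound (hYm i).aestronglyMeasurable |s| (Eventually.of_forall fun ω => hTb _)
  have hmean : ∀ i, ∫ ω, Y i ω ∂P = truncMoment ν 1 s := by
    intro i
    rw [hY]
    simp only
    rw [integral_comp_eq hmeas hν i hTm, hT, integral_indicator (measurableSet_abs_le s)]
    simp [truncMoment]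
  have hsq : ∀ i, ∫ ω, (Y i ^ 2) ω ∂P = truncMoment ν 2 s := by
    intro i
    have : ∀ x, T x ^ 2 = {y : ℝ | |y| ≤ s}.indicator (fun y => y ^ 2) x := by
      intro x
      by_cases hx : x ∈ {y : ℝ | |y| ≤ s}
      · simp only [hT, Set.indicator_of_mem hx, id]
      · simp only [hT, Set.indicator_of_notMem hx]; simp
    simp only [hY, Pi.pow_apply]
    rw [integral_comp_eq hmeas hν i (f := fun x => T x ^ 2) (hTm.pow_const 2)]
    simp_rw [this]
    rw [integral_indicator (measurableSet_abs_le s)]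
    rfl
  set Z : Ω → ℝ := ∑ i ∈ A, Y i with hZ
  have hZL : MemLp Z 2 P := memLp_finsetSum' A fun i _ => hYL i
  have hμ2 := truncMoment_two_nonneg ν s
  have hAn : (A.card : ℝ) ≤ n := by exact_mod_cast hA
  -- The truncated sum is not centred, so its squared mean is kept beside the variance.
  have hEZ : ∫ ω, (Z ^ 2) ω ∂P ≤ n * truncMoment ν 2 s + (n * truncMoment ν 1 s) ^ 2 := by
    have h1 := variance_eq_sub hZL
    have h2 : Var[Z; P] ≤ n * truncMoment ν 2 s := by
      rw [hZ, IndepFun.variance_sum (fun i _ => hYL i) fun i _ j _ hij => hYind.indepFun hij]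
      calc ∑ i ∈ A, Var[Y i; P] ≤ ∑ i ∈ A, truncMoment ν 2 s := Finset.sum_le_sum fun i _ => by
            rw [← hsq i]; exact variance_le_expectation_sq (hYm i).aestronglyMeasurable
        _ = A.card * truncMoment ν 2 s := by simp
        _ ≤ _ := by gcongr
    have h3 : ∫ ω, Z ω ∂P = A.card * truncMoment ν 1 s := by
      simp only [hZ, Finset.sum_apply]
      rw [integral_finsetSum A fun i _ => (hYL i).integrable (by norm_num)]
      simp [hmean]
    rw [h3] at h1
    have h4 : ((A.card : ℝ) * truncMoment ν 1 s) ^ 2 ≤ (n * truncMoment ν 1 s) ^ 2 := by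
      rw [mul_pow, mul_pow]; gcongr
    linarith
  have hsub : {ω | u ≤ |∑ j ∈ A, X j ω|} ⊆
      (⋃ i ∈ A, X i ⁻¹' {y | s < |y|}) ∪ {ω | u ^ 2 ≤ (Z ^ 2) ω} := by
    intro ω (hω : u ≤ |∑ j ∈ A, X j ω|)
    by_cases hall : ∀ i ∈ A, |X i ω| ≤ s
    · right
      have : Z ω = ∑ j ∈ A, X j ω := by
        rw [hZ, Finset.sum_apply]
        exact Finset.sum_congr rfl fun i hi =>
          Set.indicator_of_mem (show X i ω ∈ {y : ℝ | |y| ≤ s} from hall i hi) _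
      simp only [Set.mem_ofPred_eq, Pi.pow_apply, this]
      rw [← sq_abs (∑ j ∈ A, X j ω)]
      gcongr
    · left
      push Not at hall
      obtain ⟨i, hi, h⟩ := hall
      exact Set.mem_biUnion hi h
  have hmarkov := mul_meas_ge_le_integral_of_nonneg (μ := P) (f := Z ^ 2)
    (Eventually.of_forall fun ω => sq_nonneg (Z ω)) hZL.integrable_sq (u ^ 2)
  have hU : P.real (⋃ i ∈ A, X i ⁻¹' {y | s < |y|}) ≤ n * absTail ν s := by
    refine (measureReal_biUnion_finset_le _ _).trans ?_
    simp_rw [measureReal_preimage_eq hmeas hν _ (measurableSet_lt_abs s)]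
    rw [Finset.sum_const, nsmul_eq_mul]
    have := absTail_nonneg ν s
    rw [← absTail]
    gcongr
  refine (measureReal_mono hsub).trans ((measureReal_union_le _ _).trans (add_le_add hU ?_))
  rw [le_div_iff₀ (by positivity)]
  linarith

lemma measureReal_sum_gt_le_exp (hmeas : ∀ i, Measurable (X i)) (hindep : iIndepFun X P)
    (hν : ∀ i, P.map (X i) = ν) (n : ℕ) {s l m : ℝ} (hl : 0 < l) (hm : l⁻¹ ≤ m / 2) :
    P.real {ω | s < partialSum X n ω ∧ ∀ i < n, X i ω ≤ m} ≤
      Real.exp (-l * s + n * (l * truncMoment ν 1 l⁻¹ + l ^ 2 * truncMoment ν 2 l⁻¹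
        + Real.exp (l * m / 2) * absTail ν l⁻¹ + Real.exp (l * m) * absTail ν (m / 2))) := by
  set T : ℝ → ℝ := (Set.Iic m).indicator id with hT
  have hTm : Measurable T := measurable_id.indicator measurableSet_Iic
  set Y : ℕ → Ω → ℝ := fun i ω => T (X i ω) with hY
  have hYm : ∀ i, Measurable (Y i) := fun i => hTm.comp (hmeas i)
  have hYind : iIndepFun Y P := hindep.comp (fun _ => T) fun _ => hTm
  have hint : ∀ i, Integrable (fun ω => Real.exp (l * Y i ω)) P := by
    intro i
    have := integrable_exp_indicator ν (m := m) hl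
    rw [← hν i] at this
    exact this.comp_measurable (hmeas i)
  -- On this event the truncation changes no summand.
  have hsub : {ω | s < partialSum X n ω ∧ ∀ i < n, X i ω ≤ m} ⊆
      {ω | s ≤ (∑ i ∈ Finset.range n, Y i) ω} := by
    rintro ω ⟨h1, h2⟩
    have : (∑ i ∈ Finset.range n, Y i) ω = partialSum X n ω := by
      rw [Finset.sum_apply]
      exact Finset.sum_congr rfl fun i hi =>
        Set.indicator_of_mem (show X i ω ∈ Set.Iic m from h2 i (Finset.mem_range.1 hi)) _
    exact (h1.trans_eq this.symm).le
  refine (measureReal_mono hsub).trans ?_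
  refine (measure_ge_le_exp_mul_mgf s hl.le
    (hYind.integrable_exp_mul_sum hYm fun i _ => hint i)).trans ?_
  rw [hYind.mgf_sum hYm, Real.exp_add, Real.exp_nat_mul]
  refine mul_le_mul_of_nonneg_left ?_ (Real.exp_pos _).le
  rw [← Finset.card_range n, ← Finset.prod_const, Finset.card_range]
  refine Finset.prod_le_prod (fun i _ => mgf_nonneg) fun i _ => ?_
  rw [mgf, integral_comp_eq hmeas hν i (f := fun x => Real.exp (l * T x)) (by fun_prop)]
  exact integral_exp_indicator_le ν hl hm

/-- If some `X i` exceeds `m` but no summand exceeds `c * s`, then the other summands must supply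
more than `(1 - c) * s`, and their sum is independent of `X i`. -/
lemma measureReal_partialSum_gt_le (hmeas : ∀ i, Measurable (X i)) (hindep : iIndepFun X P)
    (hν : ∀ i, P.map (X i) = ν) (n : ℕ) {s m c b : ℝ}
    (hb : ∀ A : Finset ℕ, A.card ≤ n → P.real {ω | (1 - c) * s ≤ |∑ j ∈ A, X j ω|} ≤ b) :
    P.real {ω | s < partialSum X n ω} ≤ n * tail ν (c * s) + n * tail ν m * b +
      P.real {ω | s < partialSum X n ω ∧ ∀ i < n, X i ω ≤ m} := by
  have hsub : {ω | s < partialSum X n ω} ⊆ ((⋃ i ∈ Finset.range n, X i ⁻¹' Set.Ioi (c * s)) ∪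
      ⋃ i ∈ Finset.range n, X i ⁻¹' Set.Ioi m ∩
        {ω | ∑ j ∈ (Finset.range n).erase i, X j ω ∈ {y : ℝ | (1 - c) * s ≤ |y|}}) ∪
      {ω | s < partialSum X n ω ∧ ∀ i < n, X i ω ≤ m} := by
    intro ω (hω : s < partialSum X n ω)
    by_cases h1 : ∀ i < n, X i ω ≤ m
    · exact Or.inr ⟨hω, h1⟩
    left
    by_cases h2 : ∀ i < n, X i ω ≤ c * s
    · right
      push Not at h1
      obtain ⟨i, hi, hXi⟩ := h1
      refine Set.mem_biUnion (Finset.mem_coe.2 (Finset.mem_range.2 hi)) ⟨hXi, ?_⟩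
      have := Finset.add_sum_erase (Finset.range n) (fun j => X j ω) (Finset.mem_range.2 hi)
      have h3 := h2 i hi
      unfold partialSum at hω
      show (1 - c) * s ≤ |∑ j ∈ (Finset.range n).erase i, X j ω|
      refine le_trans ?_ (le_abs_self _)
      linarith
    · left
      push Not at h2
      obtain ⟨i, hi, hXi⟩ := h2
      exact Set.mem_biUnion (Finset.mem_coe.2 (Finset.mem_range.2 hi)) hXi
  refine (measureReal_mono hsub).trans ((measureReal_union_le _ _).trans ?_)
  gcongr
  refine (measureReal_union_le _ _).trans (add_le_add ?_ ?_)
  · refine (measureReal_biUnion_finset_le _ _).trans (le_of_eq ?_)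
    simp_rw [measureReal_preimage_eq hmeas hν _ measurableSet_Ioi, ← tail_eq_measureReal_Ioi]
    simp
  · refine (measureReal_biUnion_finset_le _ _).trans ?_
    calc _ ≤ ∑ i ∈ Finset.range n, tail ν m * b := Finset.sum_le_sum fun i _ => by
          rw [measureReal_inter_sum_eq_mul hmeas hindep hν (Finset.notMem_erase i _)
            measurableSet_Ioi (measurableSet_le measurable_const measurable_abs),
            ← tail_eq_measureReal_Ioi]
          have := tail_nonneg ν m
          gcongr
          exact hb _ ((Finset.card_erase_le).trans (by simp))
      _ = _ := by simp [mul_assoc]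

/-- The events `D i` are disjoint: `X i` alone exceeds `c * s`, and the rest cannot pull the sum
down by `(c - 1) * s`. Independence bounds what is removed from each `E i`. -/
lemma le_measureReal_partialSum_gt (hmeas : ∀ i, Measurable (X i)) (hindep : iIndepFun X P)
    (hν : ∀ i, P.map (X i) = ν) (n : ℕ) {s c b : ℝ}
    (hb : ∀ A : Finset ℕ, A.card ≤ n → P.real {ω | (c - 1) * s ≤ |∑ j ∈ A, X j ω|} ≤ b) :
    n * tail ν (c * s) * (1 - b - n * tail ν (c * s)) ≤ P.real {ω | s < partialSum X n ω} := by
  set E : ℕ → Set Ω := fun i => X i ⁻¹' Set.Ioi (c * s) with hE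
  set R : ℕ → Set Ω := fun i =>
    {ω | ∑ j ∈ (Finset.range n).erase i, X j ω ∈ {y : ℝ | (c - 1) * s ≤ |y|}} with hR
  set D : ℕ → Set Ω := fun i => (E i \ R i) \ ⋃ j ∈ (Finset.range n).erase i, E j with hD
  have hEm : ∀ i, MeasurableSet (E i) := fun i => hmeas i measurableSet_Ioi
  have hsetm : MeasurableSet {y : ℝ | (c - 1) * s ≤ |y|} :=
    measurableSet_le measurable_const measurable_abs
  have hRm : ∀ i, MeasurableSet (R i) := fun i =>
    (Finset.measurable_fun_sum _ fun j _ => hmeas j) hsetm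
  have hDm : ∀ i, MeasurableSet (D i) := fun i =>
    ((hEm i).diff (hRm i)).diff (Finset.measurableSet_biUnion _ fun j _ => hEm j)
  have hPE : ∀ i, P.real (E i) = tail ν (c * s) := fun i => by
    rw [tail_eq_measureReal_Ioi]; exact measureReal_preimage_eq hmeas hν i measurableSet_Ioi
  have hτ := tail_nonneg ν (c * s)
  have hDlb : ∀ i ∈ Finset.range n,
      tail ν (c * s) * (1 - b - n * tail ν (c * s)) ≤ P.real (D i) := by
    intro i _
    have h1 : P.real (E i ∩ R i) ≤ tail ν (c * s) * b := by
      rw [measureReal_inter_sum_eq_mul hmeas hindep hν (Finset.notMem_erase i _)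
        measurableSet_Ioi hsetm, ← tail_eq_measureReal_Ioi]
      gcongr
      exact hb _ ((Finset.card_erase_le).trans (by simp))
    have h2 : P.real (E i ∩ ⋃ j ∈ (Finset.range n).erase i, E j) ≤
        n * (tail ν (c * s) * tail ν (c * s)) := by
      rw [Set.inter_iUnion₂]
      refine (measureReal_biUnion_finset_le _ _).trans ?_
      calc _ ≤ ∑ j ∈ (Finset.range n).erase i, tail ν (c * s) * tail ν (c * s) :=
            Finset.sum_le_sum fun j hj => le_of_eq (by
              have hij : i ≠ j := (Finset.ne_of_mem_erase hj).symm
              rw [measureReal_def, hE]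
              simp only
              rw [(hindep.indepFun hij).measure_inter_preimage_eq_mul _ _ measurableSet_Ioi
                measurableSet_Ioi, ENNReal.toReal_mul]
              exact congrArg₂ _ (hPE i) (hPE j))
        _ = ((Finset.range n).erase i).card * (tail ν (c * s) * tail ν (c * s)) := by simp
        _ ≤ _ := by
            gcongr
            exact (Finset.card_erase_le).trans (by simp)
    have h3 : E i ⊆ D i ∪ ((E i ∩ R i) ∪ (E i ∩ ⋃ j ∈ (Finset.range n).erase i, E j)) := by
      intro ω hω
      by_cases hr : ω ∈ R i
      · exact Or.inr (Or.inl ⟨hω, hr⟩)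
      by_cases he : ω ∈ ⋃ j ∈ (Finset.range n).erase i, E j
      · exact Or.inr (Or.inr ⟨hω, he⟩)
      · exact Or.inl ⟨⟨hω, hr⟩, he⟩
    have h4 := (measureReal_mono (μ := P) h3).trans ((measureReal_union_le _ _).trans
      (add_le_add le_rfl (measureReal_union_le _ _)))
    rw [hPE] at h4
    linarith
  have hdisj : (↑(Finset.range n) : Set ℕ).PairwiseDisjoint D := by
    intro i hi j _ hij
    rw [Function.onFun, Set.disjoint_left]
    rintro ω h1 h2
    exact h2.2 (Set.mem_biUnion (Finset.mem_coe.2 (Finset.mem_erase.2 ⟨hij, hi⟩)) h1.1.1)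
  have hsub : (⋃ i ∈ Finset.range n, D i) ⊆ {ω | s < partialSum X n ω} := by
    intro ω hω
    obtain ⟨i, hi, hωi⟩ := Set.mem_iUnion₂.1 hω
    have h1 : c * s < X i ω := hωi.1.1
    have h2 : ¬ (c - 1) * s ≤ |∑ j ∈ (Finset.range n).erase i, X j ω| := hωi.1.2
    have h3 := neg_abs_le (∑ j ∈ (Finset.range n).erase i, X j ω)
    have h4 := Finset.add_sum_erase (Finset.range n) (fun j => X j ω) hi
    show s < ∑ j ∈ Finset.range n, X j ω
    linarith
  calc n * tail ν (c * s) * (1 - b - n * tail ν (c * s))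
      = ∑ i ∈ Finset.range n, tail ν (c * s) * (1 - b - n * tail ν (c * s)) := by
        simp [mul_assoc]
    _ ≤ ∑ i ∈ Finset.range n, P.real (D i) := Finset.sum_le_sum hDlb
    _ = P.real (⋃ i ∈ Finset.range n, D i) :=
        (measureReal_biUnion_finset hdisj fun i _ => hDm i).symm
    _ ≤ _ := measureReal_mono hsub

end Sums

/-! ### Polynomial decay and the Chernoff exponent. -/

lemma RegVarying.exists_neg_log_le {G : ℝ → ℝ} {α : ℝ} (hG : ∀ x, 0 < G x) (hanti : Antitone G)
    (h : RegVarying G (-α)) : ∃ A : ℝ, 0 < A ∧ ∀ᶠ x in atTop, -Real.log (G x) ≤ A * Real.log x := by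
  obtain ⟨a, C, x₀, hC, hx₀, hpot⟩ := h.exists_potter hG hanti
  -- The exponent `a` comes from the Potter bound at a fixed starting point; the additional 1
  -- absorbs the constants, since `log x → ∞`.
  refine ⟨a + 1, by positivity, ?_⟩
  filter_upwards [eventually_ge_atTop x₀, Real.tendsto_log_atTop.eventually_ge_atTop
    (Real.log C - a * Real.log x₀ - Real.log (G x₀))] with x hx hlog
  have hx0 : 0 < x := hx₀.trans_le hx
  have h1 := Real.log_le_log (hG x₀) (hpot x₀ x le_rfl hx)
  rw [Real.log_mul (by positivity) (hG x).ne', Real.log_mul hC.ne' (by positivity), Real.log_pow,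
    Real.log_div hx0.ne' hx₀.ne'] at h1
  linarith

lemma eventually_mul_log_le (A : ℝ) : ∀ᶠ x : ℝ in atTop, A * Real.log x ≤ x := by
  have h : (fun x : ℝ => A * Real.log x) =o[atTop] (id : ℝ → ℝ) :=
    Real.isLittleO_log_id_atTop.const_mul_left A
  filter_upwards [h.bound one_pos, eventually_ge_atTop 0] with x hx h0
  rw [one_mul, id, Real.norm_of_nonneg h0] at hx
  exact (Real.le_norm_self _).trans hx

lemma eventually_mul_pow_mul_exp_le_one (C : ℝ) (k : ℕ) :
    ∀ᶠ L : ℝ in atTop, C * (3 * L) ^ k * Real.exp (-(L / 2)) ≤ 1 := by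
  have h := ((Real.tendsto_pow_mul_exp_neg_atTop_nhds_zero k).comp
    (tendsto_id.atTop_div_const (show (0 : ℝ) < 2 by norm_num))).const_mul (C * 6 ^ k)
  rw [mul_zero] at h
  filter_upwards [h.eventually (gt_mem_nhds one_pos)] with L hL
  refine le_trans (le_of_eq ?_) hL.le
  simp only [Function.comp, id]
  rw [show 3 * L = 6 * (L / 2) by ring, mul_pow]
  ring

section Law

variable (ν : Measure ℝ) [IsProbabilityMeasure ν] {α : ℝ}

/-- As `c` decreases to 1, `c ^ (-α)` tends to 1, so the two-sided tail loses little between `x` and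
`c * x`; comparability of the two tails passes this on to `tail ν`. -/
lemma exists_tail_sub_tail_le (hpos : ∀ x, 0 < absTail ν x) (h : RegVarying (absTail ν) (-α))
    {K : ℝ} (hK0 : 0 < K) (hK : ∀ x, 0 ≤ x → absTail ν x ≤ K * tail ν x) {η : ℝ} (hη : 0 < η) :
    ∃ c : ℝ, 1 < c ∧ ∀ᶠ x in atTop, (1 - η) * tail ν x ≤ tail ν (c * x) := by
  have hcont : Tendsto (fun c : ℝ => c ^ (-α)) (𝓝[>] 1) (𝓝 (1 ^ (-α))) :=
    (Real.continuousAt_rpow_const 1 (-α) (Or.inl one_ne_zero)).tendsto.mono_left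
      nhdsWithin_le_nhds
  rw [Real.one_rpow] at hcont
  have hlt : 1 - η / K < 1 := by have := div_pos hη hK0; linarith
  obtain ⟨c, hc, hc1⟩ :=
    ((hcont.eventually (lt_mem_nhds hlt)).and self_mem_nhdsWithin).exists
  refine ⟨c, hc1, ?_⟩
  filter_upwards [h.eventually_le_mul hpos (le_of_lt hc1) hc, eventually_ge_atTop 0] with x hx h0
  have h1 := tail_sub_tail_le ν h0 (le_mul_of_one_le_left h0 (le_of_lt hc1))
  have h2 : η / K * absTail ν x ≤ η * tail ν x := by
    rw [div_mul_eq_mul_div, div_le_iff₀ hK0]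
    calc η * absTail ν x ≤ η * (K * tail ν x) := by gcongr; exact hK x h0
      _ = _ := by ring
  linarith

/-- With `l = 3 * L / s` and `m = s / 3` one has `l * s = 3 * L` and `l * m = L`. The two moment
terms use at most `L / 2` plus a constant and the tail terms are bounded, so at least `2 * L`
survives, giving the square of `n * absTail ν s`. -/
lemma chernoff_exponent_le {n s L C : ℝ} {a : ℕ} (hn : 0 ≤ n) (hs : 0 < s) (hC : 0 < C)
    (hρ : n * absTail ν s = Real.exp (-L)) (hL : 2 ≤ L)
    (hpot : absTail ν (s / (3 * L)) ≤ C * (3 * L) ^ a * absTail ν s)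
    (hpot' : absTail ν (s / 6) ≤ C * 6 ^ a * absTail ν s)
    (h1 : |n * truncMoment ν 1 s / s| ≤ 1 / 12)
    (h2 : L * (n * truncMoment ν 2 s / s ^ 2) ≤ 1 / 36)
    (h3 : C * (3 * L) ^ (a + 1) * Real.exp (-(L / 2)) ≤ 1) :
    -(3 * L / s) * s + n * (3 * L / s * truncMoment ν 1 (3 * L / s)⁻¹
        + (3 * L / s) ^ 2 * truncMoment ν 2 (3 * L / s)⁻¹
        + Real.exp (3 * L / s * (s / 3) / 2) * absTail ν (3 * L / s)⁻¹
        + Real.exp (3 * L / s * (s / 3)) * absTail ν (s / 3 / 2)) ≤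
      -(2 * L) + (2 + C * 6 ^ a) := by
  have hL0 : 0 < L := by linarith
  rw [inv_div, show 3 * L / s * (s / 3) = L by field_simp, show s / 3 / 2 = s / 6 by ring,
    neg_mul, div_mul_cancel₀ _ hs.ne']
  set r := s / (3 * L) with hr
  have hrs : r ≤ s := div_le_self hs.le (by linarith)
  have hG : n * absTail ν r ≤ C * (3 * L) ^ a * Real.exp (-L) := by
    rw [← hρ]
    calc n * absTail ν r ≤ n * (C * (3 * L) ^ a * absTail ν s) := by gcongr
      _ = _ := by ring
  have hhalf : Real.exp (-L) = Real.exp (-(L / 2)) * Real.exp (-(L / 2)) := by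
    rw [← Real.exp_add]; ring_nf
  have hle1 : Real.exp (-(L / 2)) ≤ 1 := Real.exp_le_one_iff.2 (by linarith)
  have b1 : n * (3 * L / s * truncMoment ν 1 r) ≤ L / 4 + 1 := by
    have e1 := (abs_le.1 (abs_truncMoment_one_sub_le ν hrs hs.le)).1
    have e2 : truncMoment ν 1 r ≤ truncMoment ν 1 s + s * absTail ν r := by linarith
    calc n * (3 * L / s * truncMoment ν 1 r)
        ≤ n * (3 * L / s * (truncMoment ν 1 s + s * absTail ν r)) := by gcongr
      _ = 3 * L * (n * truncMoment ν 1 s / s) + 3 * L * (n * absTail ν r) := by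
          field_simp
      _ ≤ 3 * L * (1 / 12) + 3 * L * (C * (3 * L) ^ a * Real.exp (-L)) := by
          exact add_le_add (mul_le_mul_of_nonneg_left ((le_abs_self _).trans h1) (by positivity))
            (mul_le_mul_of_nonneg_left hG (by positivity))
      _ = L / 4 + C * (3 * L) ^ (a + 1) * Real.exp (-(L / 2)) * Real.exp (-(L / 2)) := by
          rw [hhalf]; ring
      _ ≤ L / 4 + 1 * 1 := by gcongr
      _ = _ := by ring
  have b2 : n * ((3 * L / s) ^ 2 * truncMoment ν 2 r) ≤ L / 4 := by
    calc n * ((3 * L / s) ^ 2 * truncMoment ν 2 r)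
        ≤ n * ((3 * L / s) ^ 2 * truncMoment ν 2 s) := by
          gcongr; exact truncMoment_two_mono ν hrs
      _ = 9 * L * (L * (n * truncMoment ν 2 s / s ^ 2)) := by field_simp; ring
      _ ≤ 9 * L * (1 / 36) := by gcongr
      _ = _ := by ring
  -- The Potter loss at level `s / (3 * L)` is polynomial in `L`; half of `exp (-L)` remains to
  -- absorb it.
  have b3 : n * (Real.exp (L / 2) * absTail ν r) ≤ 1 := by
    calc n * (Real.exp (L / 2) * absTail ν r) = Real.exp (L / 2) * (n * absTail ν r) := by ring
      _ ≤ Real.exp (L / 2) * (C * (3 * L) ^ a * Real.exp (-L)) := by gcongr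
      _ = C * (3 * L) ^ a * Real.exp (-(L / 2)) := by
          rw [show -(L / 2) = L / 2 + -L by ring, Real.exp_add]; ring
      _ ≤ C * (3 * L) ^ (a + 1) * Real.exp (-(L / 2)) := by
          gcongr
          · linarith
          · omega
      _ ≤ 1 := h3
  have b4 : n * (Real.exp L * absTail ν (s / 6)) ≤ C * 6 ^ a := by
    calc n * (Real.exp L * absTail ν (s / 6))
        ≤ n * (Real.exp L * (C * 6 ^ a * absTail ν s)) := by gcongr
      _ = Real.exp L * (n * absTail ν s) * (C * 6 ^ a) := by ring
      _ = C * 6 ^ a := by rw [hρ, ← Real.exp_add]; simp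
  linarith

end Law

/-! ### The asymptotics along a sequence of levels. -/

section Sums

variable {Ω : Type*} [MeasurableSpace Ω] {P : Measure Ω} [IsProbabilityMeasure P]
  {X : ℕ → Ω → ℝ} {ν : Measure ℝ} [IsProbabilityMeasure ν] {α : ℝ}

/-- The large deviation asymptotics along a sequence of levels. -/
theorem tendsto_measureReal_partialSum_gt_div (hmeas : ∀ i, Measurable (X i))
    (hindep : iIndepFun X P) (hν : ∀ i, P.map (X i) = ν) (hpos : ∀ x, 0 < absTail ν x)
    (hRV : RegVarying (absTail ν) (-α)) {K : ℝ} (hK0 : 0 < K)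
    (hK : ∀ x, 0 ≤ x → absTail ν x ≤ K * tail ν x) (htail : ∀ x, 0 < tail ν x)
    {s : ℕ → ℝ} (hs : Tendsto s atTop atTop)
    (hρ : Tendsto (fun n : ℕ => (n : ℝ) * absTail ν (s n)) atTop (𝓝 0))
    (h1 : Tendsto (fun n : ℕ => (n : ℝ) * truncMoment ν 1 (s n) / s n) atTop (𝓝 0))
    (h2 : Tendsto (fun n : ℕ => -Real.log ((n : ℝ) * absTail ν (s n)) *
      ((n : ℝ) * truncMoment ν 2 (s n) / s n ^ 2)) atTop (𝓝 0)) :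
    Tendsto (fun n : ℕ => P.real {ω | s n < partialSum X n ω} / (n * tail ν (s n)))
      atTop (𝓝 1) := by
  obtain ⟨a, C, x₀, hC, hx₀, hpot⟩ := hRV.exists_potter hpos (absTail_antitone ν)
  obtain ⟨A, hA, hAlog⟩ := hRV.exists_neg_log_le hpos (absTail_antitone ν)
  set L : ℕ → ℝ := fun n => -Real.log ((n : ℝ) * absTail ν (s n)) with hLdef
  have hn1 : ∀ᶠ n : ℕ in atTop, (1 : ℝ) ≤ n := by
    filter_upwards [eventually_ge_atTop 1] with n hn using by exact_mod_cast hn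
  have hρ0 : ∀ᶠ n : ℕ in atTop, 0 < (n : ℝ) * absTail ν (s n) := by
    filter_upwards [hn1] with n hn
    have := hpos (s n)
    positivity
  have hL : Tendsto L atTop atTop :=
    tendsto_neg_atBot_atTop.comp (Real.tendsto_log_nhdsGT_zero.comp
      (tendsto_nhdsWithin_iff.2 ⟨hρ, hρ0⟩))
  have hspos : ∀ᶠ n in atTop, 0 < s n := hs.eventually_gt_atTop 0
  -- `L n` grows at most like `log (s n)`, so `s n / (3 * L n)` stays in the range of the Potter
  -- bound.
  have hsL : ∀ᶠ n in atTop, x₀ ≤ s n / (3 * L n) := by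
    filter_upwards [hs.eventually hAlog, hs.eventually (eventually_mul_log_le (x₀ * 3 * A)),
      hn1, hL.eventually_ge_atTop 2] with n e1 e2 e3 e4
    rw [le_div_iff₀ (by linarith)]
    have : L n ≤ A * Real.log (s n) := by
      refine le_trans ?_ e1
      simp only [hLdef]
      have := Real.log_le_log (hpos (s n)) (le_mul_of_one_le_left (hpos (s n)).le e3)
      linarith
    calc x₀ * (3 * L n) ≤ x₀ * (3 * (A * Real.log (s n))) := by gcongr
      _ = x₀ * 3 * A * Real.log (s n) := by ring
      _ ≤ _ := e2
  set D : ℝ := Real.exp (2 + C * 6 ^ a) with hD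
  have hchern : ∀ᶠ n : ℕ in atTop,
      P.real {ω | s n < partialSum X n ω ∧ ∀ i < n, X i ω ≤ s n / 3} ≤
        D * ((n : ℝ) * absTail ν (s n)) ^ 2 := by
    filter_upwards [hρ0, hspos, hsL, hL.eventually_ge_atTop 2,
      hL.eventually (eventually_mul_pow_mul_exp_le_one C (a + 1)),
      hs.eventually_ge_atTop (6 * x₀),
      (tendsto_zero_iff_abs_tendsto_zero _).1 h1 |>.eventually
        (ge_mem_nhds (show (0 : ℝ) < 1 / 12 by norm_num)),
      h2.eventually (ge_mem_nhds (show (0 : ℝ) < 1 / 36 by norm_num))]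
      with n e0 e1 e2 e3 e4 e5 e6 e7
    have hexp : (n : ℝ) * absTail ν (s n) = Real.exp (-L n) := by
      rw [hLdef]; simp [Real.exp_log e0]
    have hp1 := hpot (s n / (3 * L n)) (s n) e2 (div_le_self e1.le (by linarith))
    have hp2 := hpot (s n / 6) (s n) (by linarith) (by linarith)
    rw [div_div_cancel₀ e1.ne'] at hp1 hp2
    have hlm : (3 * L n / s n)⁻¹ ≤ s n / 3 / 2 := by
      rw [inv_div, div_div]
      gcongr
    refine (measureReal_sum_gt_le_exp hmeas hindep hν n (l := 3 * L n / s n)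
      (by have : 0 < L n := by linarith
          positivity) hlm).trans ?_
    have := chernoff_exponent_le ν (Nat.cast_nonneg n) e1 hC hexp e3 hp1 hp2 e6 e7 e4
    refine (Real.exp_le_exp.2 this).trans (le_of_eq ?_)
    rw [hexp, ← Real.exp_nat_mul, hD, Real.exp_add, mul_comm]
    congr 2
    push_cast; ring
  have h2' : Tendsto (fun n : ℕ => (n : ℝ) * truncMoment ν 2 (s n) / s n ^ 2) atTop (𝓝 0) := by
    refine tendsto_of_tendsto_of_tendsto_of_le_of_le' tendsto_const_nhds h2
      (Eventually.of_forall fun n => ?_) ?_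
    · have := truncMoment_two_nonneg ν (s n)
      positivity
    · filter_upwards [hL.eventually_ge_atTop 1] with n hn
      have := truncMoment_two_nonneg ν (s n)
      exact le_mul_of_one_le_left (by positivity) hn
  set b : ℝ → ℕ → ℝ := fun u n => n * absTail ν (s n) + (n * truncMoment ν 2 (s n) +
    (n * truncMoment ν 1 (s n)) ^ 2) / (u * s n) ^ 2 with hb
  have hb0 : ∀ u : ℝ, Tendsto (b u) atTop (𝓝 0) := by
    intro u
    have := hρ.add ((h2'.add (h1.pow 2)).div_const (u ^ 2))
    simp only [ne_eq, OfNat.ofNat_ne_zero, not_false_eq_true, zero_pow, add_zero, zero_div] at this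
    refine this.congr fun n => ?_
    rw [hb]
    simp only
    rw [div_pow, ← add_div, div_div, mul_pow u, mul_comm (u ^ 2)]
  have hbP : ∀ u : ℝ, 0 < u → ∀ n, 0 < s n → ∀ B : Finset ℕ, B.card ≤ n →
      P.real {ω | u * s n ≤ |∑ j ∈ B, X j ω|} ≤ b u n := fun u hu n hsn B hB =>
    measureReal_le_abs_sum_le hmeas hindep hν B hB (by positivity)
  rw [Metric.tendsto_atTop']
  intro ε hε
  -- The final relative error is at most `3 * η < ε`; the cap `1 / 4` ensures `1 / (1 - η) ≤ 1 + 2 *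
  -- η`.
  set η := min (ε / 4) (1 / 4) with hη
  have hη0 : 0 < η := by positivity
  have hη1 : η ≤ 1 / 4 := min_le_right _ _
  have hηε : η ≤ ε / 4 := min_le_left _ _
  obtain ⟨c, hc, hcx⟩ := exists_tail_sub_tail_le ν hpos hRV hK0 hK hη0
  have hc0 : 0 < c := by linarith
  have hci : c⁻¹ < 1 := inv_lt_one_of_one_lt₀ hc
  -- The relative errors of the second and third upper-bound events, and of the lower bound.
  have hup := ((hb0 (1 - c⁻¹)).const_mul (C * 3 ^ a * K)).add (hρ.const_mul (D * K))
  have hlow := (hb0 (c - 1)).add hρ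
  simp only [mul_zero, add_zero] at hup hlow
  have hsc : Tendsto (fun n => c⁻¹ * s n) atTop atTop := hs.const_mul_atTop (inv_pos.2 hc0)
  have hev : ∀ᶠ n : ℕ in atTop,
      dist (P.real {ω | s n < partialSum X n ω} / (n * tail ν (s n))) 1 < ε := by
    filter_upwards [hn1, hspos, hchern, hs.eventually hcx, hsc.eventually hcx,
      hs.eventually_ge_atTop (3 * x₀), hup.eventually (ge_mem_nhds hη0),
      hlow.eventually (ge_mem_nhds hη0)] with n e1 e2 e3 e4 e5 e6 e7 e8
    have hT := htail (s n)
    have hnT : 0 < n * tail ν (s n) := by positivity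
    have hKs := hK (s n) e2.le
    have hup1 := measureReal_partialSum_gt_le hmeas hindep hν n (s := s n) (m := s n / 3)
      (c := c⁻¹) (hbP (1 - c⁻¹) (by linarith) n e2)
    have hlow1 := le_measureReal_partialSum_gt hmeas hindep hν n (s := s n) (c := c)
      (hbP (c - 1) (by linarith) n e2)
    rw [mul_inv_cancel_left₀ hc0.ne'] at e5
    have hbnn : 0 ≤ b (1 - c⁻¹) n := by
      have := truncMoment_two_nonneg ν (s n)
      have := absTail_nonneg ν (s n)
      rw [hb]; positivity
    have u1 : tail ν (c⁻¹ * s n) ≤ (1 + 2 * η) * tail ν (s n) := by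
      have h0 := htail (c⁻¹ * s n)
      nlinarith [mul_nonneg hη0.le (sub_nonneg.2 hη1), mul_pos hη0 h0,
        mul_nonneg (mul_nonneg hη0.le (sub_nonneg.2 hη1)) h0.le]
    have u2 : tail ν (s n / 3) ≤ C * 3 ^ a * K * tail ν (s n) := by
      have hp := hpot (s n / 3) (s n) (by linarith) (by linarith)
      rw [div_div_cancel₀ e2.ne'] at hp
      calc tail ν (s n / 3) ≤ absTail ν (s n / 3) := tail_le_absTail ν _
        _ ≤ C * 3 ^ a * absTail ν (s n) := hp
        _ ≤ C * 3 ^ a * (K * tail ν (s n)) := by gcongr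
        _ = _ := by ring
    have u3 : D * ((n : ℝ) * absTail ν (s n)) ^ 2 ≤
        D * K * (n * absTail ν (s n)) * (n * tail ν (s n)) := by
      have hD0 : 0 < D := Real.exp_pos _
      have := absTail_nonneg ν (s n)
      calc D * ((n : ℝ) * absTail ν (s n)) ^ 2
          = D * (n * absTail ν (s n)) * (n * absTail ν (s n)) := by ring
        _ ≤ D * (n * absTail ν (s n)) * (n * (K * tail ν (s n))) := by gcongr
        _ = _ := by ring
    have hU : P.real {ω | s n < partialSum X n ω} ≤ (1 + 3 * η) * (n * tail ν (s n)) := by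
      calc P.real {ω | s n < partialSum X n ω}
          ≤ n * ((1 + 2 * η) * tail ν (s n)) + n * (C * 3 ^ a * K * tail ν (s n)) *
              b (1 - c⁻¹) n + D * K * (n * absTail ν (s n)) * (n * tail ν (s n)) := by
            refine hup1.trans (add_le_add (add_le_add ?_ ?_) (e3.trans u3))
            · gcongr
            · gcongr
        _ = (1 + 2 * η + (C * 3 ^ a * K * b (1 - c⁻¹) n + D * K * (n * absTail ν (s n)))) *
              (n * tail ν (s n)) := by ring
        _ ≤ (1 + 2 * η + η) * (n * tail ν (s n)) := by gcongr
        _ = _ := by ring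
    have hLo : (1 - 2 * η) * (n * tail ν (s n)) ≤ P.real {ω | s n < partialSum X n ω} := by
      have l1 : n * tail ν (c * s n) ≤ n * absTail ν (s n) := by
        gcongr
        exact (tail_le_absTail ν _).trans
          (absTail_antitone ν (le_mul_of_one_le_left e2.le hc.le))
      have l2 : (1 - η) * (n * tail ν (s n)) ≤ n * tail ν (c * s n) := by
        calc (1 - η) * (n * tail ν (s n)) = n * ((1 - η) * tail ν (s n)) := by ring
          _ ≤ _ := by gcongr
      calc (1 - 2 * η) * (n * tail ν (s n)) ≤ (1 - η) * (n * tail ν (s n)) * (1 - η) := by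
            nlinarith [mul_nonneg (sq_nonneg η) hnT.le]
        _ ≤ n * tail ν (c * s n) * (1 - b (c - 1) n - n * tail ν (c * s n)) := by
            refine mul_le_mul l2 (by linarith) (by linarith) ?_
            have := tail_nonneg ν (c * s n)
            positivity
        _ ≤ _ := hlow1
    rw [Real.dist_eq, abs_lt]
    rw [← le_div_iff₀ hnT] at hLo
    rw [← div_le_iff₀ hnT] at hU
    constructor <;> linarith
  obtain ⟨N, hN⟩ := eventually_atTop.1 hev
  exact ⟨N, fun n hn => hN n hn.le⟩

end Sums

/-! ### Verifying the moment conditions at all levels above `t n`. -/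

section Levels

variable (ν : Measure ℝ) [IsProbabilityMeasure ν] {α : ℝ}

lemma exists_absTail_le_mul_tail
    (hp : ∃ p : ℝ, ∀ x : ℝ, 0 ≤ x → cdf ν (-x) ≤ p * tail ν x) :
    ∃ K : ℝ, 0 < K ∧ ∀ x, 0 ≤ x → absTail ν x ≤ K * tail ν x := by
  obtain ⟨p, hp⟩ := hp
  refine ⟨1 + |p|, by positivity, fun x hx => absTail_le_mul_tail ν ((hp x hx).trans ?_)⟩
  have := tail_nonneg ν x
  gcongr
  exact le_abs_self p

lemma tail_pos (hpos : ∀ x, 0 < absTail ν x) {K : ℝ} (hK0 : 0 < K)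
    (hK : ∀ x, 0 ≤ x → absTail ν x ≤ K * tail ν x) (x : ℝ) : 0 < tail ν x := by
  have h : 0 < K * tail ν (max x 0) := (hpos _).trans_le (hK _ (le_max_right _ _))
  exact (pos_of_mul_pos_right h hK0.le).trans_le (tail_antitone ν (le_max_left _ _))

/-- If `t n < M` for large `n`, then `n * tail ν (t n)` is at least the positive constant `tail ν
M`. -/
lemma tendsto_atTop_of_tendsto_mul_tail (htail : ∀ x, 0 < tail ν x) {t : ℕ → ℝ}
    (ht : Tendsto (fun n : ℕ => (n : ℝ) * tail ν (t n)) atTop (𝓝 0)) :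
    Tendsto t atTop atTop := by
  refine tendsto_atTop.2 fun M => ?_
  filter_upwards [ht.eventually (gt_mem_nhds (htail M)), eventually_ge_atTop 1] with n h1 h2
  by_contra! h
  have h3 : (1 : ℝ) ≤ n := by exact_mod_cast h2
  have h4 := tail_antitone ν h.le
  have h5 := le_mul_of_one_le_left (htail (t n)).le h3
  linarith

lemma tendsto_mul_absTail_of_le {K : ℝ}
    (hK : ∀ x, 0 ≤ x → absTail ν x ≤ K * tail ν x) {t s : ℕ → ℝ} (hts : ∀ n, t n ≤ s n)
    (htop : Tendsto t atTop atTop)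
    (ht : Tendsto (fun n : ℕ => (n : ℝ) * tail ν (t n)) atTop (𝓝 0)) :
    Tendsto (fun n : ℕ => (n : ℝ) * absTail ν (s n)) atTop (𝓝 0) := by
  have h := ht.const_mul K
  rw [mul_zero] at h
  refine tendsto_of_tendsto_of_tendsto_of_le_of_le' tendsto_const_nhds h
    (Eventually.of_forall fun n => mul_nonneg n.cast_nonneg (absTail_nonneg ν _)) ?_
  filter_upwards [htop.eventually_ge_atTop 0] with n hn
  calc (n : ℝ) * absTail ν (s n) ≤ n * (K * tail ν (t n)) := by
        gcongr
        exact (absTail_antitone ν (hts n)).trans (hK _ hn)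
    _ = _ := by ring

lemma tendsto_truncMoment_one_of_lt_one (hpos : ∀ x, 0 < absTail ν x)
    (hRV : RegVarying (absTail ν) (-α)) (hα : α < 1) {s : ℕ → ℝ} (hs : Tendsto s atTop atTop)
    (hρ : Tendsto (fun n : ℕ => (n : ℝ) * absTail ν (s n)) atTop (𝓝 0)) :
    Tendsto (fun n : ℕ => (n : ℝ) * truncMoment ν 1 (s n) / s n) atTop (𝓝 0) := by
  obtain ⟨C, hC⟩ := exists_absMoment_le ν hpos hRV 1 (by simpa using hα)
  have h := hρ.const_mul C
  rw [mul_zero] at h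
  refine squeeze_zero_norm' ?_ h
  filter_upwards [hs.eventually hC, hs.eventually_gt_atTop 0] with n h1 h2
  rw [Real.norm_eq_abs, abs_div, abs_mul, Nat.abs_cast, abs_of_pos h2, div_le_iff₀ h2]
  calc (n : ℝ) * |truncMoment ν 1 (s n)| ≤ n * (C * s n ^ 1 * absTail ν (s n)) := by
        gcongr; exact (abs_truncMoment_one_le ν _).trans h1
    _ = _ := by ring

lemma tendsto_truncMoment_one_of_le {t s : ℕ → ℝ} (hts : ∀ n, t n ≤ s n)
    (htop : Tendsto t atTop atTop)
    (hρ : Tendsto (fun n : ℕ => (n : ℝ) * absTail ν (t n)) atTop (𝓝 0))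
    (h : Tendsto (fun n : ℕ => (n : ℝ) / t n * truncMoment ν 1 (t n)) atTop (𝓝 0)) :
    Tendsto (fun n : ℕ => (n : ℝ) * truncMoment ν 1 (s n) / s n) atTop (𝓝 0) := by
  have h' := ((tendsto_zero_iff_abs_tendsto_zero _).1 h).add hρ
  rw [add_zero] at h'
  refine squeeze_zero_norm' ?_ h'
  filter_upwards [htop.eventually_gt_atTop 0] with n ht0
  have hs0 : 0 < s n := ht0.trans_le (hts n)
  have h1 := abs_truncMoment_one_sub_le ν (hts n) hs0.le
  have h2 : |truncMoment ν 1 (s n)| ≤ |truncMoment ν 1 (t n)| + s n * absTail ν (t n) := by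
    have := abs_sub_abs_le_abs_sub (truncMoment ν 1 (s n)) (truncMoment ν 1 (t n))
    linarith
  simp only [Function.comp, Real.norm_eq_abs]
  rw [abs_div, abs_mul, abs_mul, abs_div, Nat.abs_cast, abs_of_pos hs0, abs_of_pos ht0]
  calc n * |truncMoment ν 1 (s n)| / s n
      ≤ n * (|truncMoment ν 1 (t n)| + s n * absTail ν (t n)) / s n := by gcongr
    _ = n * |truncMoment ν 1 (t n)| / s n + n * absTail ν (t n) := by field_simp
    _ ≤ n * |truncMoment ν 1 (t n)| / t n + n * absTail ν (t n) := by gcongr; exact hts n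
    _ = _ := by ring

/-- Karamata bounds the second factor by a multiple of `n * absTail ν (s n)`, and `x * log x → 0` at
0. -/
lemma tendsto_truncMoment_two_of_lt_two (hpos : ∀ x, 0 < absTail ν x)
    (hRV : RegVarying (absTail ν) (-α)) (hα : α < 2) {s : ℕ → ℝ} (hs : Tendsto s atTop atTop)
    (hρ : Tendsto (fun n : ℕ => (n : ℝ) * absTail ν (s n)) atTop (𝓝 0)) :
    Tendsto (fun n : ℕ => -Real.log ((n : ℝ) * absTail ν (s n)) *
      ((n : ℝ) * truncMoment ν 2 (s n) / s n ^ 2)) atTop (𝓝 0) := by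
  obtain ⟨C, hC⟩ := exists_absMoment_le ν hpos hRV 2 (by simpa using hα)
  have h := ((Real.continuous_mul_log.tendsto 0).comp hρ).const_mul (-C)
  simp only [zero_mul, mul_zero] at h
  refine tendsto_of_tendsto_of_tendsto_of_le_of_le' tendsto_const_nhds h ?_ ?_
  all_goals
    filter_upwards [hs.eventually hC, hs.eventually_gt_atTop 0,
      hρ.eventually (ge_mem_nhds one_pos)] with n h1 h2 h3
    have h4 := truncMoment_two_nonneg ν (s n)
    have h5 : 0 ≤ -Real.log ((n : ℝ) * absTail ν (s n)) := neg_nonneg.2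
      (Real.log_nonpos (mul_nonneg n.cast_nonneg (absTail_nonneg ν _)) h3)
  · positivity
  · rw [← truncMoment_two_eq] at h1
    calc -Real.log ((n : ℝ) * absTail ν (s n)) * ((n : ℝ) * truncMoment ν 2 (s n) / s n ^ 2)
        ≤ -Real.log ((n : ℝ) * absTail ν (s n)) *
          ((n : ℝ) * (C * s n ^ 2 * absTail ν (s n)) / s n ^ 2) := by gcongr
      _ = _ := by simp only [Function.comp]; field_simp

/-- The mean is finite, and it differs from the truncated mean by `O(s * absTail ν s)`. -/
lemma tendsto_truncMoment_one_of_one_lt (hpos : ∀ x, 0 < absTail ν x)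
    (hRV : RegVarying (absTail ν) (-α)) (hα : 1 < α) {t s : ℕ → ℝ} (hts : ∀ n, t n ≤ s n)
    (htop : Tendsto t atTop atTop)
    (hρ : Tendsto (fun n : ℕ => (n : ℝ) * absTail ν (s n)) atTop (𝓝 0))
    (h : Tendsto (fun n : ℕ => (n : ℝ) * (∫ x, x ∂ν) / t n) atTop (𝓝 0)) :
    Tendsto (fun n : ℕ => (n : ℝ) * truncMoment ν 1 (s n) / s n) atTop (𝓝 0) := by
  obtain ⟨C, hC0, hC⟩ := exists_absMoment_gt_le ν hpos hRV hα
  have h' := ((tendsto_zero_iff_abs_tendsto_zero _).1 h).add (hρ.const_mul C)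
  rw [mul_zero, add_zero] at h'
  have hs : Tendsto s atTop atTop := tendsto_atTop_mono hts htop
  refine squeeze_zero_norm' ?_ h'
  filter_upwards [htop.eventually_gt_atTop 0, hs.eventually hC] with n ht0 h1
  have hs0 : 0 < s n := ht0.trans_le (hts n)
  have hint : IntegrableOn (fun x : ℝ => x) {y | s n < |y|} ν :=
    (integrable_norm_iff (by fun_prop)).1 h1.1
  have hcompl : {y : ℝ | |y| ≤ s n}ᶜ = {y | s n < |y|} := by ext y; simp
  have hint' : IntegrableOn (fun x : ℝ => x) {y | |y| ≤ s n} ν := by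
    simpa using integrableOn_pow_abs_le ν 1 (s n)
  have hI : Integrable (fun x : ℝ => x) ν := by
    rw [← integrableOn_univ, ← Set.union_compl_self {y : ℝ | |y| ≤ s n}, hcompl]
    exact hint'.union hint
  have h2 := integral_add_compl (measurableSet_abs_le (s n)) hI
  rw [hcompl] at h2
  have h3 : truncMoment ν 1 (s n) = ∫ y in {y | |y| ≤ s n}, y ∂ν := by simp [truncMoment]
  have h4 : |∫ y in {y | s n < |y|}, y ∂ν| ≤ C * s n * absTail ν (s n) :=
    abs_integral_le_integral_abs.trans h1.2
  have h5 : |truncMoment ν 1 (s n)| ≤ |∫ x, x ∂ν| + C * s n * absTail ν (s n) := by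
    rw [h3, eq_sub_of_add_eq h2]
    exact (abs_sub _ _).trans (by linarith)
  simp only [Function.comp, Real.norm_eq_abs]
  rw [abs_div, abs_mul, abs_div, abs_mul, Nat.abs_cast, abs_of_pos hs0, abs_of_pos ht0]
  calc n * |truncMoment ν 1 (s n)| / s n
      ≤ n * (|∫ x, x ∂ν| + C * s n * absTail ν (s n)) / s n := by gcongr
    _ = n * |∫ x, x ∂ν| / s n + C * (n * absTail ν (s n)) := by field_simp
    _ ≤ n * |∫ x, x ∂ν| / t n + C * (n * absTail ν (s n)) := by gcongr; exact hts n

/-- For `α > 1` the tail at least halves from `x / 2` to `x`, so the annulus between them has mass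
at least `absTail ν x`, and there the integrand is at least `x ^ 2 / 4`. -/
lemma eventually_sq_mul_absTail_le (hpos : ∀ x, 0 < absTail ν x)
    (hRV : RegVarying (absTail ν) (-α)) (hα : 1 < α) :
    ∀ᶠ x in atTop, x ^ 2 * absTail ν x ≤ 4 * truncMoment ν 2 x := by
  have h2 : (2 : ℝ) ^ (-α) < 1 / 2 := by
    rw [Real.rpow_neg (by norm_num), ← one_div]
    refine one_div_lt_one_div_of_lt (by norm_num) ?_
    nth_rewrite 1 [← Real.rpow_one 2]
    exact Real.rpow_lt_rpow_of_exponent_lt one_lt_two hα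
  have hhalf : Tendsto (fun x : ℝ => x / 2) atTop atTop :=
    tendsto_id.atTop_div_const (by norm_num)
  filter_upwards [hhalf.eventually (hRV.eventually_mul_le hpos one_le_two h2),
    eventually_gt_atTop 0] with x h1 hx
  rw [mul_div_cancel₀ x (two_ne_zero)] at h1
  have h3 : (x / 2) ^ 2 * ν.real {z | x / 2 < |z| ∧ |z| ≤ x} ≤
      ∫ z in {z | x / 2 < |z| ∧ |z| ≤ x}, z ^ 2 ∂ν := by
    rw [mul_comm, ← smul_eq_mul, ← setIntegral_const]
    refine setIntegral_mono_on (integrableOn_const (measure_ne_top _ _))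
      ((integrableOn_pow_abs_le ν 2 x).mono_set fun z hz => hz.2) (measurableSet_annulus _ _)
      fun z hz => ?_
    rw [← sq_abs z]
    have := hz.1.le
    gcongr
  rw [measureReal_annulus ν (by linarith)] at h3
  have h4 := setIntegral_abs_le_eq_add ν (show x / 2 ≤ x by linarith)
    (integrableOn_pow_abs_le ν 2 x)
  have h5 := truncMoment_two_nonneg ν (x / 2)
  have h6 : truncMoment ν 2 x = truncMoment ν 2 (x / 2) + _ := h4
  have h7 : (x / 2) ^ 2 * absTail ν x ≤
      (x / 2) ^ 2 * (absTail ν (x / 2) - absTail ν x) := by gcongr; linarith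
  nlinarith

/-- The Karamata bound for second moments is unavailable when `α ≥ 2`, so everything is compared
with level `t n`. The growth of `μ₂` from `t n` to `s n` is at most linear in `s n`, which the
decrease of `log x / x` compensates. -/
lemma tendsto_truncMoment_two_of_one_lt (hpos : ∀ x, 0 < absTail ν x)
    (hRV : RegVarying (absTail ν) (-α)) (hα : 1 < α) {t s : ℕ → ℝ} (hts : ∀ n, t n ≤ s n)
    (htop : Tendsto t atTop atTop)
    (hρ : Tendsto (fun n : ℕ => (n : ℝ) * absTail ν (s n)) atTop (𝓝 0))
    (h : Tendsto (fun n : ℕ => (n : ℝ) * truncMoment ν 2 (t n) * Real.log (t n) / (t n) ^ 2)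
      atTop (𝓝 0)) :
    Tendsto (fun n : ℕ => -Real.log ((n : ℝ) * absTail ν (s n)) *
      ((n : ℝ) * truncMoment ν 2 (s n) / s n ^ 2)) atTop (𝓝 0) := by
  obtain ⟨C, hC0, hC⟩ := exists_absMoment_gt_le ν hpos hRV hα
  obtain ⟨A, hA, hAlog⟩ := hRV.exists_neg_log_le hpos (absTail_antitone ν)
  have hs : Tendsto s atTop atTop := tendsto_atTop_mono hts htop
  have h' := h.const_mul (A * (1 + 4 * C))
  rw [mul_zero] at h'
  refine tendsto_of_tendsto_of_tendsto_of_le_of_le' tendsto_const_nhds h' ?_ ?_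
  · filter_upwards [hρ.eventually (ge_mem_nhds one_pos)] with n h3
    have h4 := truncMoment_two_nonneg ν (s n)
    have h5 : 0 ≤ -Real.log ((n : ℝ) * absTail ν (s n)) := neg_nonneg.2
      (Real.log_nonpos (mul_nonneg n.cast_nonneg (absTail_nonneg ν _)) h3)
    positivity
  filter_upwards [hs.eventually hAlog, htop.eventually hC,
    htop.eventually (eventually_sq_mul_absTail_le ν hpos hRV hα),
    -- The function `log x / x` decreases from `e` onwards.
    htop.eventually_ge_atTop (Real.exp 1), eventually_ge_atTop 1] with n e1 e2 e3 e4 e5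
  have hn : (1 : ℝ) ≤ n := by exact_mod_cast e5
  have ht0 : 0 < t n := (Real.exp_pos 1).trans_le e4
  have hs0 : 0 < s n := ht0.trans_le (hts n)
  have ht1 : 1 ≤ t n := (Real.one_le_exp zero_le_one).trans e4
  have hlogt : 0 ≤ Real.log (t n) := Real.log_nonneg ht1
  have hlogs : 0 ≤ Real.log (s n) := Real.log_nonneg (ht1.trans (hts n))
  have hlog : Real.log (s n) / s n ≤ Real.log (t n) / t n :=
    Real.log_div_self_antitoneOn e4 (e4.trans (hts n)) (hts n)
  have hμt := truncMoment_two_nonneg ν (t n)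
  have hμs := truncMoment_two_nonneg ν (s n)
  have hL : -Real.log ((n : ℝ) * absTail ν (s n)) ≤ A * Real.log (s n) := by
    refine le_trans ?_ e1
    have := Real.log_le_log (hpos (s n)) (le_mul_of_one_le_left (hpos (s n)).le hn)
    linarith
  -- On the annulus `z ^ 2 ≤ s n * |z|`, and the first moment beyond `t n` is controlled because `α
  -- > 1`.
  have hμ : truncMoment ν 2 (s n) ≤ truncMoment ν 2 (t n) + s n * (C * t n * absTail ν (t n)) := by
    rw [truncMoment, setIntegral_abs_le_eq_add ν (hts n) (integrableOn_pow_abs_le ν 2 (s n)),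
      ← truncMoment]
    gcongr
    have hsub : {z : ℝ | t n < |z| ∧ |z| ≤ s n} ⊆ {z | t n < |z|} := fun z hz => hz.1
    calc ∫ z in {z | t n < |z| ∧ |z| ≤ s n}, z ^ 2 ∂ν
        ≤ ∫ z in {z | t n < |z| ∧ |z| ≤ s n}, s n * |z| ∂ν := by
          refine setIntegral_mono_on
            ((integrableOn_pow_abs_le ν 2 (s n)).mono_set fun z hz => hz.2)
            ((e2.1.mono_set hsub).const_mul _) (measurableSet_annulus _ _) fun z hz => ?_
          rw [← sq_abs, sq]
          gcongr
          exact hz.2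
      _ = s n * ∫ z in {z | t n < |z| ∧ |z| ≤ s n}, |z| ∂ν := integral_const_mul _ _
      _ ≤ s n * ∫ z in {z | t n < |z|}, |z| ∂ν := by
          gcongr
          · exact Eventually.of_forall fun z => abs_nonneg z
          · exact e2.1
      _ ≤ _ := by gcongr; exact e2.2
  calc -Real.log ((n : ℝ) * absTail ν (s n)) * ((n : ℝ) * truncMoment ν 2 (s n) / s n ^ 2)
      ≤ A * Real.log (s n) * ((n : ℝ) * (truncMoment ν 2 (t n) +
          s n * (C * t n * absTail ν (t n))) / s n ^ 2) := by gcongr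
    _ = A * n * (Real.log (s n) / s n) * (truncMoment ν 2 (t n) / s n
          + C * t n * absTail ν (t n)) := by field_simp
    _ ≤ A * n * (Real.log (t n) / t n) * (truncMoment ν 2 (t n) / t n
          + C * t n * absTail ν (t n)) := by
        have := hpos (t n)
        have := hts n
        gcongr
    _ = A * n * (Real.log (t n) / t n ^ 2) * (truncMoment ν 2 (t n)
          + C * (t n ^ 2 * absTail ν (t n))) := by field_simp
    _ ≤ A * n * (Real.log (t n) / t n ^ 2) * (truncMoment ν 2 (t n)
          + C * (4 * truncMoment ν 2 (t n))) := by gcongr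
    _ = _ := by ring

end Levels

/-- For a given `ε`, let `s n` be a level that violates the bound whenever one exists. Convergence
along this sequence rules out violations for large `n`. -/
lemma uniformLargeDev_of_forall_seq {Ω : Type*} [MeasurableSpace Ω] {P : Measure Ω}
    {X : ℕ → Ω → ℝ} {t : ℕ → ℝ}
    (h : ∀ s : ℕ → ℝ, (∀ n, t n ≤ s n) →
      Tendsto (fun n : ℕ => P.real {ω | s n < partialSum X n ω} /
        (n * tail (P.map (X 0)) (s n))) atTop (𝓝 1)) :
    UniformLargeDev P X t := by
  rw [UniformLargeDev, ENNReal.tendsto_nhds_zero]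
  intro ε hε
  -- The case `⊤` is separate because its `toReal` is 0.
  rcases eq_or_ne ε ⊤ with rfl | hεt
  · simp
  set Q : ℕ → ℝ → Prop := fun n s => ENNReal.ofReal
    |P.real {ω | s < partialSum X n ω} / (n * tail (P.map (X 0)) s) - 1| ≤ ε with hQ
  classical
  set s : ℕ → ℝ := fun n => if hn : ∃ u, t n ≤ u ∧ ¬ Q n u then hn.choose else t n with hs
  have hts : ∀ n, t n ≤ s n := by
    intro n
    simp only [hs]
    split_ifs with hn
    · exact hn.choose_spec.1
    · exact le_rfl
  have hr : 0 < ε.toReal := ENNReal.toReal_pos hε.ne' hεt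
  filter_upwards [(Metric.tendsto_nhds.1 (h s hts)) _ hr] with n hn
  have hQs : Q n (s n) := by
    simp only [hQ]
    rw [← Real.dist_eq]
    exact ENNReal.ofReal_le_of_le_toReal hn.le
  refine iSup₂_le fun u hu => ?_
  by_contra hcon
  have hex : ∃ u, t n ≤ u ∧ ¬ Q n u := ⟨u, hu, hcon⟩
  have hsn : s n = hex.choose := by simp only [hs]; rw [dif_pos hex]
  exact hex.choose_spec.2 (hsn ▸ hQs)

end LargeDev

/-! ### Assembly of the theorem. -/

open LargeDev

theorem theorem3p3 {Ω : Type*} [MeasurableSpace Ω] (P : Measure Ω) [IsProbabilityMeasure P]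
    (X : ℕ → Ω → ℝ) (hmeas : ∀ i, Measurable (X i)) (hindep : iIndepFun X P)
    (hident : ∀ i, IdentDistrib (X i) (X 0) P P)
    (α : ℝ) (hα : 0 ≤ α)
    (hRV : LargeDev.RegVarying (LargeDev.absTail (P.map (X 0))) (-α))
    (hp : ∃ p : ℝ, ∀ x : ℝ, 0 ≤ x →
      cdf (P.map (X 0)) (-x) ≤ p * LargeDev.tail (P.map (X 0)) x)
    (t : ℕ → ℝ)
    (ht : Tendsto (fun n : ℕ => (n : ℝ) * LargeDev.tail (P.map (X 0)) (t n)) atTop (𝓝 0))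
    (hcases :
      α < 1 ∨
      (1 ≤ α ∧ α < 2 ∧
        Tendsto (fun n : ℕ => (n : ℝ) / t n * LargeDev.truncMoment (P.map (X 0)) 1 (t n))
          atTop (𝓝 0)) ∨
      (2 ≤ α ∧
        Tendsto (fun n : ℕ => (n : ℝ) * (∫ ω, X 0 ω ∂P) / t n) atTop (𝓝 0) ∧
        Tendsto (fun n : ℕ => (n : ℝ) * LargeDev.truncMoment (P.map (X 0)) 2 (t n) *
          Real.log (t n) / (t n) ^ 2) atTop (𝓝 0))) :
    LargeDev.UniformLargeDev P X t := by
  have : IsProbabilityMeasure (P.map (X 0)) :=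
    Measure.isProbabilityMeasure_map (hmeas 0).aemeasurable
  have hν : ∀ i, P.map (X i) = P.map (X 0) := fun i => (hident i).map_eq
  have hE : ∫ ω, X 0 ω ∂P = ∫ x, x ∂(P.map (X 0)) :=
    integral_comp_eq hmeas hν 0 (f := fun x => x) measurable_id
  have hpos := hRV.pos (absTail_nonneg _) (absTail_antitone _)
  obtain ⟨K, hK0, hK⟩ := exists_absTail_le_mul_tail _ hp
  have htail := tail_pos _ hpos hK0 hK
  have htop := tendsto_atTop_of_tendsto_mul_tail _ htail ht
  refine uniformLargeDev_of_forall_seq fun s hts => ?_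
  have hs : Tendsto s atTop atTop := tendsto_atTop_mono hts htop
  have hρ := tendsto_mul_absTail_of_le _ hK hts htop ht
  have hρt := tendsto_mul_absTail_of_le _ hK (fun _ => le_rfl) htop ht
  refine tendsto_measureReal_partialSum_gt_div hmeas hindep hν hpos hRV hK0 hK htail hs hρ ?_ ?_
  · rcases hcases with h | ⟨-, -, h⟩ | ⟨h2, h, -⟩
    · exact tendsto_truncMoment_one_of_lt_one _ hpos hRV h hs hρ
    · exact tendsto_truncMoment_one_of_le _ hts htop hρt h
    · rw [hE] at h
      exact tendsto_truncMoment_one_of_one_lt _ hpos hRV (by linarith) hts htop hρ h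
  · rcases hcases with h | ⟨-, h, -⟩ | ⟨h2, -, h⟩
    · exact tendsto_truncMoment_two_of_lt_two _ hpos hRV (by linarith) hs hρ
    · exact tendsto_truncMoment_two_of_lt_two _ hpos hRV h hs hρ
    · exact tendsto_truncMoment_two_of_one_lt _ hpos hRV (by linarith) hts htop hρ h
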